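/- Let $\|M\|=\sqrt{\mathrm{tr}(M'M)}$ be the Frobenius norm and $\|M\|_{spec}$ the spectral norm. Fix $r$ and let $(n,m,T)$ go jointly to infinity along an arbitrary path; $O_p$ and $o$ without further comment refer to this limit. Consider the factor model $$Y_t^*=F_0X_tF_0'+Y_0^*,\qquad t=1,\dots,T,$$ where $F_0=F_0^{(n)}$ is a nonrandom $n\times r$ loading matrix with $F_0'F_0=I_r$, $Y_0^*=Y_0^{*(n)}$ is a nonrandom positive definite $n\times n$ matrix, and $X_t$ (not depending on $n,m,T$) is an $r\times r$ almost surely positive definite random factor covariance matrix. Let $Y_t=Y_t^{(n,m,T)}$ be random symmetric $n\times n$ matrices (the realized covariance matrices estimating $Y_t^*$). Assume: 1. (Stationarity) $(X_t)$ is strictly stationary and ergodic with $E\|X_t\|^3<\infty$, and the $r$ eigenvalues of $E[(X_t-EX_t)^2]$ are positive and pairwise distinct. 2. (Sparsity) For some $\delta_*\in[0,1)$, $U>0$ and deterministic $\pi(n)$, all rows $(x_1,\dots,x_n)$ of $F_0'$ and of $Y_0^*$ satisfy $\sum_{i=1}^n|x_i|^{\delta_*}\le U\pi(n)$ (with $0^0=0$).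 3. $\sup_n\|Y_0^*\|_{spec}<\infty$, and for each $j=1,\dots,r$, $\max_{1\le t\le T}|X_{t,jj}|=O_p(B(T))$, where $1\le B(T)=o(T)$. 4. $\max_{1\le t\le T}\|Y_t^*-Y_t\|_{spec}=O_p(A(n,m,T))$, where $A\ge 0$ and $A(n,m,T)B^5(T)=o(1)$. Let $\overline Y^*=\frac1T\sum_{t=1}^TY_t^*$, $\overline S^*=\frac1T\sum_{t=1}^T(Y_t^*-\overline Y^*)^2$, and let $\overline Y,\overline S$ be defined in the same way from $Y_1,\dots,Y_T$. Let $F=(f_1,\dots,f_r)$ and $\widehat F=(\widehat f_1,\dots,\widehat f_r)$ consist of orthonormal eigenvectors of $\overline S^*$ and of $\overline S$, respectively, corresponding to the $r$ largest eigenvalues in decreasing order, with signs chosen such that $f_j'\widehat f_j\ge 0$ for all $j$. In the coordinates given by $F$ the factor covariance matrix is $Y_{ft}^*=(F_0'F)'X_t(F_0'F)$; put $Y_{ft}=Y_{ft}^*+F'Y_0^*F$ and $\widehat Y_{ft}=\widehat F'Y_t\widehat F$. Then, as $n,m,T\to\infty$, (i) $\|F'\widehat F-I_r\|=O_p\big(A(n,m,T)B(T)\big)$;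 (ii) $\max_{1\le t\le T}\|\widehat Y_{ft}-Y_{ft}\|=O_p\big(A^{1/2}(n,m,T)B^{3/2}(T)\big)$. -/

import Mathlib

open MeasureTheory Filter Topology
open scoped Matrix

namespace FactorModel

noncomputable section

/-- Stochastic boundedness along a filter: `Z_p = O_p(a_p)`. -/
def IsBigOp {Ω ι : Type*} [MeasurableSpace Ω] (μ : Measure Ω) (l : Filter ι)
    (Z : ι → Ω → ℝ) (a : ι → ℝ) : Prop :=
  ∀ ε : ℝ, 0 < ε → ∃ C : ℝ, 0 < C ∧
    ∀ᶠ p in l, μ {ω | C * a p < |Z p ω|} ≤ ENNReal.ofReal ε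

/-- The maximum of `f 1, …, f T` (for nonnegative `f`; it is `0` when `T = 0`). -/
def maxUpTo (T : ℕ) (f : ℕ → ℝ) : ℝ := ⨆ t : Finset.Icc 1 T, f t

/-- Frobenius norm `√tr(A'A)`. -/
def frobNorm {a b : ℕ} (A : Matrix (Fin a) (Fin b) ℝ) : ℝ := √(Aᵀ * A).trace

/-- Spectral norm: the operator norm on Euclidean space. -/
def specNorm {n : ℕ} (A : Matrix (Fin n) (Fin n) ℝ) : ℝ :=
  ‖Matrix.toEuclideanCLM (n := Fin n) (𝕜 := ℝ) A‖

/-- Sparsity `∑ |x_i|^δ ≤ c` (for `δ = 0` the left side counts the nonzero coordinates). -/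
def IsSparse {n : ℕ} (δ c : ℝ) (x : Fin n → ℝ) : Prop :=
  ∑ i, (if x i = 0 then 0 else |x i| ^ δ) ≤ c

/-- Sample mean of `M 1, …, M T`. -/
def sampleMean {n : ℕ} (T : ℕ) (M : ℕ → Matrix (Fin n) (Fin n) ℝ) : Matrix (Fin n) (Fin n) ℝ :=
  (T : ℝ)⁻¹ • ∑ t ∈ Finset.Icc 1 T, M t

/-- Sample dispersion `T⁻¹ ∑ (M t - mean)²` of `M 1, …, M T`. -/
def sampleDispersion {n : ℕ} (T : ℕ) (M : ℕ → Matrix (Fin n) (Fin n) ℝ) :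
    Matrix (Fin n) (Fin n) ℝ :=
  (T : ℝ)⁻¹ • ∑ t ∈ Finset.Icc 1 T, (M t - sampleMean T M) ^ 2

/-- The columns of `F` are orthonormal eigenvectors of `S` belonging to its `r` largest
eigenvalues (counted with multiplicity), in decreasing order. -/
def IsLeadingEigenvectors {n r : ℕ} (S : Matrix (Fin n) (Fin n) ℝ)
    (F : Matrix (Fin n) (Fin r) ℝ) : Prop :=
  Fᵀ * F = 1 ∧ ∃ lam : Fin r → ℝ, Antitone lam ∧
    (∀ j, S *ᵥ F.col j = lam j • F.col j) ∧
    ∀ (v : Fin n → ℝ) (κ : ℝ), v ≠ 0 → S *ᵥ v = κ • v → Fᵀ *ᵥ v = 0 → ∀ j, κ ≤ lam j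

/-- The integrated volatility matrix `Y* = Λ X Λ' + Y₀` of the factor model. -/
def modelCov {n r : ℕ} (Λ : Matrix (Fin n) (Fin r) ℝ) (Y₀ : Matrix (Fin n) (Fin n) ℝ)
    (X : Matrix (Fin r) (Fin r) ℝ) : Matrix (Fin n) (Fin n) ℝ :=
  Λ * X * Λᵀ + Y₀

/-- `Y_f = Y_f* + F' Y₀ F`, where `Y_f* = (Λ'F)' X (Λ'F)` is the factor covariance matrix after
the loading matrix `Λ` has been replaced by the loading matrix `F` (if `F = Λ R` with `R`
orthogonal, then `Λ'F = R` and `Y_f* = R⁻¹ X R⁻¹'`). -/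
def factorCov {n r : ℕ} (Λ F : Matrix (Fin n) (Fin r) ℝ) (Y₀ : Matrix (Fin n) (Fin n) ℝ)
    (X : Matrix (Fin r) (Fin r) ℝ) : Matrix (Fin r) (Fin r) ℝ :=
  (Λᵀ * F)ᵀ * X * (Λᵀ * F) + Fᵀ * Y₀ * F

/-- The estimated factor covariance matrix `F̂' Y F̂`. -/
def estFactorCov {n r : ℕ} (Fhat : Matrix (Fin n) (Fin r) ℝ) (Y : Matrix (Fin n) (Fin n) ℝ) :
    Matrix (Fin r) (Fin r) ℝ :=
  Fhatᵀ * Y * Fhat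

/-- `X` is a (measurable) strictly stationary and ergodic matrix process: the shift preserves the
law of the path and is ergodic for it. -/
def IsStationaryErgodic {Ω : Type*} [MeasurableSpace Ω] {r : ℕ} (μ : Measure Ω)
    (X : ℕ → Ω → Matrix (Fin r) (Fin r) ℝ) : Prop :=
  (∀ t i j, Measurable fun ω => X t ω i j) ∧
    Ergodic (fun (x : ℕ → Fin r → Fin r → ℝ) t => x (t + 1)) (μ.map fun ω t i j => X t ω i j)

/-- Entrywise expectation of a random matrix. -/
def expect {Ω : Type*} [MeasurableSpace Ω] {r : ℕ} (μ : Measure Ω)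
    (Z : Ω → Matrix (Fin r) (Fin r) ℝ) : Matrix (Fin r) (Fin r) ℝ :=
  Matrix.of fun i j => ∫ ω, Z ω i j ∂μ

/-- Population dispersion `E (Z - E Z)²`. -/
def dispersion {Ω : Type*} [MeasurableSpace Ω] {r : ℕ} (μ : Measure Ω)
    (Z : Ω → Matrix (Fin r) (Fin r) ℝ) : Matrix (Fin r) (Fin r) ℝ :=
  expect μ fun ω => (Z ω - expect μ Z) ^ 2

/-- `V` is symmetric with distinct and positive eigenvalues. -/
def HasSimplePositiveSpectrum {r : ℕ} (V : Matrix (Fin r) (Fin r) ℝ) : Prop :=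
  ∃ h : V.PosDef, Function.Injective h.isHermitian.eigenvalues

end

end FactorModel

/-! Centring removes `Y₀`, and since `Λ'Λ = 1` the dispersion of the model is `Λ S_X Λ'`, where
`S_X` is the `r × r` sample dispersion of the factors (`sampleDispersion_modelCov`). The relevant
spectrum therefore lives in fixed dimension `r`, whatever `n` is. The mean ergodic theorem gives
`S_X → V` in probability, with `V` the population dispersion. The eigenvalues of `V` are positive
and separated by some `g > 0`, and Weyl's inequality (`IsLeadingEigenpairs.eigenvalue_le`) carries
this gap over to both sample dispersions.

With high probability the factors are `O(B)` and the covariance errors `O(A)`, so the two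
dispersions differ by `O(AB)`. For (i), the identity `f_i'(S̄ - S̄*) f̂_j = (λ̂_j - λ_i) f_i' f̂_j`
and the gap control the off-diagonal entries of `F'F̂`. On the diagonal, `S̄*` vanishes off the span
of `F`, so `f̂_j` has only a small component there, and the sign convention puts `f_j' f̂_j` near
`1` rather than `-1` (`abs_transpose_mul_sub_one_le`).

For (ii), `‖F̂ - F‖²` is linear in `F'F̂ - I`, hence `‖F̂ - F‖ = O(√(AB))`
(`norm_sub_le_sqrt_of_entries`). Multiplied by `max ‖Y_t*‖ = O(B)` this is `A^{1/2} B^{3/2}`, which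
dominates the direct error `A`. `error_bounds` collects both estimates on one good event. -/

namespace FactorModel

/-! ### The mean ergodic theorem in `L¹`. -/

section Ergodic

variable {α : Type*} [MeasurableSpace α] {ν : Measure α} {S : α → α}

lemma aestronglyMeasurable_birkhoffAverage (hS : MeasurePreserving S ν ν) {f : α → ℝ}
    (hf : AEStronglyMeasurable f ν) (N : ℕ) :
    AEStronglyMeasurable (birkhoffAverage ℝ S f N) ν := by
  have h : birkhoffAverage ℝ S f N = (N : ℝ)⁻¹ • ∑ k ∈ Finset.range N, f ∘ S^[k] := by
    ext x
    simp [birkhoffAverage, birkhoffSum]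
  rw [h]
  exact (Finset.aestronglyMeasurable_sum _ fun k _ =>
    hf.comp_measurePreserving (hS.iterate k)).const_smul _

/-- Minkowski plus invariance of `ν`. This contraction property, uniform in `N`, is what lets
convergence pass from `L²` to `L¹` by density. -/
lemma eLpNorm_birkhoffAverage_le (hS : MeasurePreserving S ν ν) {f : α → ℝ}
    (hf : AEStronglyMeasurable f ν) (N : ℕ) :
    eLpNorm (birkhoffAverage ℝ S f N) 1 ν ≤ eLpNorm f 1 ν := by
  rcases Nat.eq_zero_or_pos N with rfl | hN
  · simp [birkhoffAverage_zero']
  have h : birkhoffAverage ℝ S f N = (N : ℝ)⁻¹ • ∑ k ∈ Finset.range N, f ∘ S^[k] := by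
    ext x
    simp [birkhoffAverage, birkhoffSum]
  have h1 : eLpNorm (∑ k ∈ Finset.range N, f ∘ S^[k]) 1 ν ≤ N * eLpNorm f 1 ν := by
    refine (eLpNorm_sum_le (fun k _ => hf.comp_measurePreserving (hS.iterate k)) le_rfl).trans ?_
    rw [Finset.sum_congr rfl fun k _ => eLpNorm_comp_measurePreserving hf (hS.iterate k)]
    simp
  rw [h, eLpNorm_const_smul]
  refine (mul_le_mul_right h1 _).trans ?_
  rw [← mul_assoc]
  have h2 : ‖(N : ℝ)⁻¹‖ₑ * (N : ENNReal) = 1 := by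
    have hN' : (N : ℝ) ≠ 0 := by positivity
    rw [enorm_inv hN', Real.enorm_natCast]
    exact ENNReal.inv_mul_cancel (by exact_mod_cast hN.ne') (by simp)
  rw [h2, one_mul]

lemma integral_birkhoffAverage (hS : MeasurePreserving S ν ν) {f : α → ℝ}
    (hf : Integrable f ν) {N : ℕ} (hN : N ≠ 0) :
    ∫ x, birkhoffAverage ℝ S f N x ∂ν = ∫ x, f x ∂ν := by
  have h (k : ℕ) : ∫ x, f (S^[k] x) ∂ν = ∫ x, f x ∂ν := by
    have hm := hS.iterate k
    rw [← integral_map hm.measurable.aemeasurable (by rw [hm.map_eq]; exact hf.1), hm.map_eq]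
  have hN' : (N : ℝ) ≠ 0 := by exact_mod_cast hN
  simp only [birkhoffAverage, birkhoffSum, smul_eq_mul]
  rw [integral_const_mul, integral_finsetSum (f := fun k x => f (S^[k] x)) _ fun k _ =>
    (hS.iterate k).integrable_comp_of_integrable hf, Finset.sum_congr rfl fun k _ => h k]
  simp [hN']

/-- Bridge between von Neumann's theorem, which concerns the Koopman isometry on classes in `L²`,
and averages of actual functions along orbits. -/
lemma coeFn_birkhoffAverage_compMeasurePreserving [IsProbabilityMeasure ν]
    (hS : MeasurePreserving S ν ν)
    (g : Lp ℝ 2 ν) (N : ℕ) :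
    (birkhoffAverage ℝ (Lp.compMeasurePreservingₗᵢ (E := ℝ) (p := 2) ℝ S hS) _root_.id N g :
      Lp ℝ 2 ν) =ᵐ[ν] birkhoffAverage ℝ S g N := by
  set V := Lp.compMeasurePreservingₗᵢ (E := ℝ) (p := 2) ℝ S hS
  have hit (k : ℕ) : (V^[k] g : Lp ℝ 2 ν) =ᵐ[ν] g ∘ S^[k] := by
    induction k with
    | zero => simp
    | succ k ih =>
      rw [Function.iterate_succ_apply']
      refine (Lp.coeFn_compMeasurePreserving _ hS).trans ?_
      have := hS.quasiMeasurePreserving.ae_eq_comp ih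
      simpa [Function.comp_assoc, ← Function.iterate_succ] using this
  have hsum (s : Finset ℕ) : ((∑ k ∈ s, V^[k] g : Lp ℝ 2 ν) : α → ℝ) =ᵐ[ν]
      fun x => ∑ k ∈ s, g (S^[k] x) := by
    induction s using Finset.induction_on with
    | empty =>
      simp only [Finset.sum_empty]
      exact Lp.coeFn_zero ℝ 2 ν
    | insert k s hk ih =>
      rw [Finset.sum_insert hk]
      filter_upwards [Lp.coeFn_add (V^[k] g) (∑ k ∈ s, V^[k] g), ih, hit k] with x h1 h2 h3
      rw [h1, Pi.add_apply, h2, h3, Finset.sum_insert hk]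
      rfl
  have := Lp.coeFn_smul (N : ℝ)⁻¹ (∑ k ∈ Finset.range N, V^[k] g)
  filter_upwards [this, hsum (Finset.range N)] with x h1 h2
  simp only [birkhoffAverage, birkhoffSum, _root_.id]
  rw [h1, Pi.smul_apply, h2]

/-- Mean ergodic theorem in `L¹` for square integrable functions. -/
lemma tendsto_eLpNorm_birkhoffAverage_of_memLp_two [IsProbabilityMeasure ν] (hS : Ergodic S ν)
    {f : α → ℝ} (hf : MemLp f 2 ν) :
    Tendsto (fun N => eLpNorm (fun x => birkhoffAverage ℝ S f N x - ∫ y, f y ∂ν) 1 ν)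
      atTop (𝓝 0) := by
  have hmp := hS.toMeasurePreserving
  set V := Lp.compMeasurePreservingₗᵢ (E := ℝ) (p := 2) ℝ S hmp
  set g : Lp ℝ 2 ν := hf.toLp f
  have hfg : g =ᵐ[ν] f := hf.coeFn_toLp
  have hfi : Integrable f ν := hf.integrable (by norm_num)
  -- Von Neumann: the averages converge in `L²` to the projection of `g` onto the fixed vectors of
  -- `V`. Ergodicity then makes this invariant limit constant.
  obtain ⟨q, hqV, hq⟩ : ∃ q : Lp ℝ 2 ν, V q = q ∧
      Tendsto (fun N => birkhoffAverage ℝ V _root_.id N g) atTop (𝓝 q) :=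
    ⟨_, (((V.toContinuousLinearMap : Lp ℝ 2 ν →ₗ[ℝ] Lp ℝ 2 ν).eqLocus
        ((1 : Lp ℝ 2 ν →L[ℝ] Lp ℝ 2 ν) : Lp ℝ 2 ν →ₗ[ℝ] Lp ℝ 2 ν)).orthogonalProjectionOnto g).2,
      V.toContinuousLinearMap.tendsto_birkhoffAverage_orthogonalProjection
        V.norm_toContinuousLinearMap_le g⟩
  obtain ⟨c, hc⟩ : ∃ c, q =ᵐ[ν] Function.const α c := by
    refine hS.ae_eq_const_of_ae_eq_comp_ae (Lp.aestronglyMeasurable q) ?_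
    have := Lp.coeFn_compMeasurePreserving q hmp
    refine this.symm.trans ?_
    exact (congrArg (fun z : Lp ℝ 2 ν => (z : α → ℝ)) hqV).eventuallyEq
  have hae (N : ℕ) : (birkhoffAverage ℝ V _root_.id N g : Lp ℝ 2 ν) =ᵐ[ν]
      birkhoffAverage ℝ S f N := by
    refine (coeFn_birkhoffAverage_compMeasurePreserving hmp g N).trans ?_
    have : ∀ᵐ x ∂ν, ∀ k : ℕ, g (S^[k] x) = f (S^[k] x) :=
      ae_all_iff.2 fun k => (hmp.iterate k).quasiMeasurePreserving.ae hfg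
    filter_upwards [this] with x hx
    simp [birkhoffAverage, birkhoffSum, hx]
  have hconv : Tendsto (fun N => eLpNorm (fun x => birkhoffAverage ℝ S f N x - c) 1 ν)
      atTop (𝓝 0) := by
    have h2 := (Lp.tendsto_Lp_iff_tendsto_eLpNorm' _ _).1 hq
    refine tendsto_of_tendsto_of_tendsto_of_le_of_le tendsto_const_nhds h2 (fun _ => zero_le)
      fun N => ?_
    have : (fun x => birkhoffAverage ℝ S f N x - c) =ᵐ[ν]
        ((birkhoffAverage ℝ V _root_.id N g : Lp ℝ 2 ν) - q : α → ℝ) := by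
      filter_upwards [hae N, hc] with x h1 h2
      simp [h1, h2]
    rw [eLpNorm_congr_ae this]
    exact eLpNorm_le_eLpNorm_of_exponent_le (by norm_num)
      ((Lp.aestronglyMeasurable _).sub (Lp.aestronglyMeasurable _))
  suffices hcf : c = ∫ y, f y ∂ν by rwa [← hcf]
  -- The constant is identified by integrating: every average with `N ≠ 0` has the integral of `f`,
  -- and `L¹` convergence preserves integrals.
  have hbd (N : ℕ) (hN : N ≠ 0) :
      ENNReal.ofReal |(∫ y, f y ∂ν) - c| ≤
        eLpNorm (fun x => birkhoffAverage ℝ S f N x - c) 1 ν := by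
    have hi : Integrable (birkhoffAverage ℝ S f N) ν := by
      have h : MemLp (birkhoffAverage ℝ S f N) 1 ν :=
        ⟨aestronglyMeasurable_birkhoffAverage hmp hf.1 N,
          (eLpNorm_birkhoffAverage_le hmp hf.1 N).trans_lt (memLp_one_iff_integrable.2 hfi).2⟩
      exact memLp_one_iff_integrable.1 h
    have h1 : ∫ x, (birkhoffAverage ℝ S f N x - c) ∂ν = (∫ y, f y ∂ν) - c := by
      rw [integral_sub hi (integrable_const c), integral_birkhoffAverage hmp hfi hN]
      simp
    rw [← h1, eLpNorm_one_eq_lintegral_enorm, ← Real.norm_eq_abs, ofReal_norm]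
    exact enorm_integral_le_lintegral_enorm _
  have h0 : ENNReal.ofReal |(∫ y, f y ∂ν) - c| ≤ 0 :=
    ge_of_tendsto hconv ((eventually_ne_atTop 0).mono hbd)
  have h1 : |(∫ y, f y ∂ν) - c| ≤ 0 := ENNReal.ofReal_eq_zero.1 (le_antisymm h0 zero_le)
  have h2 := abs_nonpos_iff.1 h1
  linarith

/-- Mean ergodic theorem in `L¹`. -/
theorem tendsto_eLpNorm_birkhoffAverage [IsProbabilityMeasure ν] (hS : Ergodic S ν)
    {f : α → ℝ} (hf : Integrable f ν) :
    Tendsto (fun N => eLpNorm (fun x => birkhoffAverage ℝ S f N x - ∫ y, f y ∂ν) 1 ν)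
      atTop (𝓝 0) := by
  have hmp := hS.toMeasurePreserving
  rw [ENNReal.tendsto_nhds_zero]
  intro ε hε
  have hε3 : ε / 3 ≠ 0 := (ENNReal.div_pos hε.ne' (by norm_num)).ne'
  obtain ⟨g, hg, hg2⟩ : ∃ g : α → ℝ, eLpNorm (f - g) 1 ν < ε / 3 ∧ MemLp g 2 ν := by
    obtain ⟨g, hg, -⟩ := (memLp_one_iff_integrable.2 hf).exists_simpleFunc_eLpNorm_sub_lt
      (by norm_num) hε3
    exact ⟨g, hg, g.memLp_of_isFiniteMeasure 2 ν⟩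
  have hgi : Integrable g ν := hg2.integrable (by norm_num)
  have hlim := tendsto_eLpNorm_birkhoffAverage_of_memLp_two hS hg2
  rw [ENNReal.tendsto_nhds_zero] at hlim
  filter_upwards [hlim (ε / 3) (pos_iff_ne_zero.2 hε3)] with N hN
  have hdm : AEStronglyMeasurable (f - g) ν := hf.1.sub hgi.1
  -- Three errors of size `ε / 3`: the average of `f - g` (contraction), the centred average of `g`
  -- (the `L²` case), and the difference of the means.
  have hsplit : (fun x => birkhoffAverage ℝ S f N x - ∫ y, f y ∂ν) =
      (birkhoffAverage ℝ S (f - g) N + fun x => birkhoffAverage ℝ S g N x - ∫ y, g y ∂ν) +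
        fun _ => -∫ y, (f - g) y ∂ν := by
    ext x
    simp only [Pi.add_apply, Pi.sub_apply, integral_sub hf hgi]
    simp [birkhoffAverage, birkhoffSum, Finset.sum_sub_distrib]
    ring
  have h1 : eLpNorm (fun _ : α => -∫ y, (f - g) y ∂ν) 1 ν ≤ ε / 3 := by
    rw [eLpNorm_const _ one_ne_zero (NeZero.ne ν)]
    simp only [enorm_neg, measure_univ, ENNReal.one_rpow, mul_one]
    refine (enorm_integral_le_lintegral_enorm _).trans ?_
    rw [← eLpNorm_one_eq_lintegral_enorm]
    exact hg.le
  have hm1 := aestronglyMeasurable_birkhoffAverage hmp hdm N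
  have hm2 : AEStronglyMeasurable (fun x => birkhoffAverage ℝ S g N x - ∫ y, g y ∂ν) ν :=
    (aestronglyMeasurable_birkhoffAverage hmp hgi.1 N).sub aestronglyMeasurable_const
  rw [hsplit]
  refine (eLpNorm_add_le (hm1.add hm2) aestronglyMeasurable_const le_rfl).trans ?_
  refine (add_le_add (eLpNorm_add_le hm1 hm2 le_rfl) h1).trans ?_
  refine (add_le_add (add_le_add ((eLpNorm_birkhoffAverage_le hmp hdm N).trans hg.le) hN)
    le_rfl).trans ?_
  rw [ENNReal.add_thirds]

end Ergodic

/-! ### Norm comparisons, leading eigenpairs, and eigenvalue inequalities. -/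

section LinearAlgebra

open scoped Matrix.Norms.L2Operator

lemma specNorm_eq_norm {n : ℕ} (M : Matrix (Fin n) (Fin n) ℝ) : specNorm M = ‖M‖ :=
  Matrix.l2_opNorm_toEuclideanCLM M

lemma norm_transpose {a b : ℕ} (M : Matrix (Fin a) (Fin b) ℝ) : ‖Mᵀ‖ = ‖M‖ := by
  rw [← Matrix.conjTranspose_eq_transpose_of_trivial, Matrix.l2_opNorm_conjTranspose]

lemma norm_transpose_mul_self {a b : ℕ} (M : Matrix (Fin a) (Fin b) ℝ) :
    ‖Mᵀ * M‖ = ‖M‖ * ‖M‖ := by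
  rw [← Matrix.conjTranspose_eq_transpose_of_trivial, Matrix.l2_opNorm_conjTranspose_mul_self]

lemma norm_one_le {n : ℕ} : ‖(1 : Matrix (Fin n) (Fin n) ℝ)‖ ≤ 1 := by
  rw [← Matrix.diagonal_one, Matrix.l2_opNorm_diagonal]
  exact (pi_norm_le_iff_of_nonneg zero_le_one).2 fun _ => by simp

lemma norm_le_one_of_transpose_mul_self {a b : ℕ} {M : Matrix (Fin a) (Fin b) ℝ}
    (h : Mᵀ * M = 1) : ‖M‖ ≤ 1 := by
  have h1 := norm_transpose_mul_self M
  have h2 : ‖(1 : Matrix (Fin b) (Fin b) ℝ)‖ ≤ 1 := norm_one_le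
  rw [h] at h1
  nlinarith [norm_nonneg M]

lemma dotProduct_mulVec_sq_le {a b : ℕ} (M : Matrix (Fin a) (Fin b) ℝ) (x : Fin a → ℝ)
    (y : Fin b → ℝ) : (x ⬝ᵥ M *ᵥ y) ^ 2 ≤ ‖M‖ ^ 2 * (x ⬝ᵥ x) * (y ⬝ᵥ y) := by
  have hn {c : ℕ} (z : Fin c → ℝ) : ‖WithLp.toLp 2 z‖ ^ 2 = z ⬝ᵥ z := by
    rw [EuclideanSpace.real_norm_sq_eq]
    simp [dotProduct, sq]
  have h1 : |x ⬝ᵥ M *ᵥ y| ≤ ‖WithLp.toLp 2 x‖ * (‖M‖ * ‖WithLp.toLp 2 y‖) := by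
    have h2 := abs_real_inner_le_norm (WithLp.toLp 2 x) (WithLp.toLp 2 (M *ᵥ y))
    have h3 := Matrix.l2_opNorm_mulVec M (WithLp.toLp 2 y)
    have h4 : inner ℝ (WithLp.toLp 2 x) (WithLp.toLp 2 (M *ᵥ y)) = x ⬝ᵥ M *ᵥ y := by
      rw [EuclideanSpace.inner_toLp_toLp, dotProduct_comm]
      simp
    rw [h4] at h2
    exact h2.trans (mul_le_mul_of_nonneg_left h3 (norm_nonneg _))
  calc (x ⬝ᵥ M *ᵥ y) ^ 2 = |x ⬝ᵥ M *ᵥ y| ^ 2 := (sq_abs _).symm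
    _ ≤ (‖WithLp.toLp 2 x‖ * (‖M‖ * ‖WithLp.toLp 2 y‖)) ^ 2 :=
        pow_le_pow_left₀ (abs_nonneg _) h1 2
    _ = ‖M‖ ^ 2 * (x ⬝ᵥ x) * (y ⬝ᵥ y) := by rw [← hn x, ← hn y]; ring

lemma dotProduct_self_nonneg_real {a : ℕ} (x : Fin a → ℝ) : 0 ≤ x ⬝ᵥ x :=
  Finset.sum_nonneg fun i _ => mul_self_nonneg (x i)

lemma abs_dotProduct_mulVec_self_le {a : ℕ} (M : Matrix (Fin a) (Fin a) ℝ) (x : Fin a → ℝ) :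
    |x ⬝ᵥ M *ᵥ x| ≤ ‖M‖ * (x ⬝ᵥ x) := by
  refine abs_le_of_sq_le_sq ?_ (mul_nonneg (norm_nonneg _) (dotProduct_self_nonneg_real x))
  refine (dotProduct_mulVec_sq_le M x x).trans_eq ?_
  ring

lemma abs_entry_le_norm {a b : ℕ} (M : Matrix (Fin a) (Fin b) ℝ) (i : Fin a) (j : Fin b) :
    |M i j| ≤ ‖M‖ := by
  refine abs_le_of_sq_le_sq ?_ (norm_nonneg _)
  have h := dotProduct_mulVec_sq_le M (Pi.single i 1) (Pi.single j 1)
  simpa using h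

lemma frobNorm_eq {a b : ℕ} (M : Matrix (Fin a) (Fin b) ℝ) :
    frobNorm M = √(∑ j, ∑ i, M i j ^ 2) := by
  simp [frobNorm, Matrix.trace, Matrix.mul_apply, sq]

lemma abs_entry_le_frobNorm {a b : ℕ} (M : Matrix (Fin a) (Fin b) ℝ) (i : Fin a) (j : Fin b) :
    |M i j| ≤ frobNorm M := by
  rw [frobNorm_eq]
  refine Real.abs_le_sqrt ?_
  refine le_trans ?_ (Finset.single_le_sum (f := fun j => ∑ i, M i j ^ 2)
    (fun j _ => Finset.sum_nonneg fun i _ => sq_nonneg _) (Finset.mem_univ j))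
  exact Finset.single_le_sum (f := fun i => M i j ^ 2) (fun i _ => sq_nonneg _)
    (Finset.mem_univ i)

lemma frobNorm_le {r : ℕ} {M : Matrix (Fin r) (Fin r) ℝ} {c : ℝ} (hc : 0 ≤ c)
    (h : ∀ i j, |M i j| ≤ c) : frobNorm M ≤ r * c := by
  rw [frobNorm_eq]
  refine Real.sqrt_le_iff.2 ⟨by positivity, ?_⟩
  calc ∑ j, ∑ i, M i j ^ 2 ≤ ∑ _j : Fin r, ∑ _i : Fin r, c ^ 2 :=
        Finset.sum_le_sum fun j _ => Finset.sum_le_sum fun i _ => by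
          rw [← sq_abs]
          exact pow_le_pow_left₀ (abs_nonneg _) (h i j) 2
    _ = (r * c) ^ 2 := by simp; ring

/-- The sum of the spectral norms of the matrix units. -/
noncomputable def unitNormSum (r : ℕ) : ℝ :=
  ∑ i : Fin r, ∑ j : Fin r, ‖Matrix.single i j (1 : ℝ)‖

lemma unitNormSum_nonneg (r : ℕ) : 0 ≤ unitNormSum r :=
  Finset.sum_nonneg fun _ _ => Finset.sum_nonneg fun _ _ => norm_nonneg _

/-- Triangle inequality over the expansion in matrix units. The constant depends on `r` alone, so it
stays fixed as `n` grows. -/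
lemma norm_le_unitNormSum_mul {r : ℕ} {M : Matrix (Fin r) (Fin r) ℝ} {c : ℝ}
    (h : ∀ i j, |M i j| ≤ c) : ‖M‖ ≤ unitNormSum r * c := by
  have hM : M = ∑ i, ∑ j, M i j • Matrix.single i j (1 : ℝ) := by
    conv_lhs => rw [Matrix.matrix_eq_sum_single M]
    simp [Matrix.smul_single]
  rw [hM, unitNormSum, Finset.sum_mul]
  refine (norm_sum_le _ _).trans (Finset.sum_le_sum fun i _ => ?_)
  rw [Finset.sum_mul]
  refine (norm_sum_le _ _).trans (Finset.sum_le_sum fun j _ => ?_)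
  rw [norm_smul, mul_comm, Real.norm_eq_abs]
  exact mul_le_mul_of_nonneg_left (h i j) (norm_nonneg _)

/-- The columns of `F` are orthonormal eigenvectors of `S` for its `r` largest eigenvalues `lam`. -/
structure IsLeadingEigenpairs {n r : ℕ} (S : Matrix (Fin n) (Fin n) ℝ)
    (F : Matrix (Fin n) (Fin r) ℝ) (lam : Fin r → ℝ) : Prop where
  orthonormal : Fᵀ * F = 1
  antitone : Antitone lam
  mul_eq : S * F = F * Matrix.diagonal lam
  le_of_orthogonal : ∀ (v : Fin n → ℝ) (κ : ℝ), v ≠ 0 → S *ᵥ v = κ • v → Fᵀ *ᵥ v = 0 →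
    ∀ j, κ ≤ lam j

lemma mul_diagonal_col {n r : ℕ} (F : Matrix (Fin n) (Fin r) ℝ) (lam : Fin r → ℝ) (j : Fin r) :
    (F * Matrix.diagonal lam).col j = lam j • F.col j := by
  ext i
  simp [Matrix.mul_diagonal, mul_comm]

lemma IsLeadingEigenvectors.exists_eigenpairs {n r : ℕ} {S : Matrix (Fin n) (Fin n) ℝ}
    {F : Matrix (Fin n) (Fin r) ℝ} (h : IsLeadingEigenvectors S F) :
    ∃ lam, IsLeadingEigenpairs S F lam := by
  obtain ⟨h1, lam, h2, h3, h4⟩ := h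
  refine ⟨lam, h1, h2, ?_, h4⟩
  ext i j
  have := congrFun (h3 j) i
  rw [Matrix.mul_diagonal]
  simpa [Matrix.mul_apply, Matrix.mulVec, dotProduct, mul_comm] using this

namespace IsLeadingEigenpairs

variable {n r : ℕ} {S S' : Matrix (Fin n) (Fin n) ℝ} {F F' : Matrix (Fin n) (Fin r) ℝ}
  {lam lam' : Fin r → ℝ}

lemma mulVec_col (h : IsLeadingEigenpairs S F lam) (j : Fin r) :
    S *ᵥ F.col j = lam j • F.col j := by
  have := congrArg (fun M : Matrix (Fin n) (Fin r) ℝ => M.col j) h.mul_eq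
  simp only [mul_diagonal_col] at this
  rw [← this]
  rfl

lemma dotProduct_mulVec_eq (h : IsLeadingEigenpairs S F lam) (c : Fin r → ℝ) :
    (F *ᵥ c) ⬝ᵥ S *ᵥ (F *ᵥ c) = ∑ i, lam i * c i ^ 2 := by
  rw [Matrix.mulVec_mulVec, h.mul_eq, Matrix.dotProduct_mulVec, Matrix.vecMul_mulVec,
    ← Matrix.mul_assoc, h.orthonormal, Matrix.one_mul]
  simp only [dotProduct, Matrix.vecMul_diagonal]
  exact Finset.sum_congr rfl fun i _ => by ring

/-- Courant–Fischer upper bound on the orthogonal complement of the first eigenvectors. -/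
lemma rayleigh_le (h : IsLeadingEigenpairs S F lam) (hS : Sᵀ = S) (j : Fin r) {v : Fin n → ℝ}
    (hv : ∀ i < j, (Fᵀ *ᵥ v) i = 0) : v ⬝ᵥ S *ᵥ v ≤ lam j * (v ⬝ᵥ v) := by
  -- `N` vanishes on the span of `F`, because `F D F'` cancels `lam j - S` there, and equals `lam j
  -- - S` on the orthogonal complement. So `N ≥ 0` is exactly the maximality of the chosen
  -- eigenvalues.
  set D : Matrix (Fin r) (Fin r) ℝ := Matrix.diagonal fun i => lam j - lam i with hD
  set N : Matrix (Fin n) (Fin n) ℝ := lam j • 1 - S - F * D * Fᵀ with hN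
  have hNF : N * F = 0 := by
    rw [hN, Matrix.sub_mul, Matrix.sub_mul, Matrix.mul_assoc, h.orthonormal, Matrix.mul_one,
      h.mul_eq]
    ext a b
    simp [hD, Matrix.mul_diagonal]
    ring
  have hNt : Nᵀ = N := by
    simp [hN, hD, Matrix.transpose_mul, hS, Matrix.mul_assoc]
  have hFN : Fᵀ * N = 0 := by
    have := congrArg Matrix.transpose hNF
    rwa [Matrix.transpose_mul, hNt, Matrix.transpose_zero] at this
  have hherm : N.IsHermitian := by
    rw [Matrix.IsHermitian, Matrix.conjTranspose_eq_transpose_of_trivial, hNt]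
  have hpsd : N.PosSemidef := by
    rw [hherm.posSemidef_iff_eigenvalues_nonneg]
    intro k
    by_contra hneg
    simp only [Pi.zero_apply, not_le] at hneg
    set u : Fin n → ℝ := (hherm.eigenvectorBasis k).ofLp with hu
    have hu0 : u ≠ 0 := by
      intro h0
      apply hherm.eigenvectorBasis.orthonormal.ne_zero k
      ext i
      exact congrFun h0 i
    have hev : N *ᵥ u = hherm.eigenvalues k • u := hherm.mulVec_eigenvectorBasis k
    -- An eigenvector of `N` for a nonzero eigenvalue is orthogonal to `F`, since `F' N = 0`.
    have hFu : Fᵀ *ᵥ u = 0 := by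
      have h1 : Fᵀ *ᵥ (N *ᵥ u) = 0 := by rw [Matrix.mulVec_mulVec, hFN, Matrix.zero_mulVec]
      rw [hev, Matrix.mulVec_smul] at h1
      exact (smul_eq_zero.1 h1).resolve_left hneg.ne
    have hSu : S *ᵥ u = (lam j - hherm.eigenvalues k) • u := by
      have h2 : N *ᵥ u = lam j • u - S *ᵥ u := by
        rw [hN, Matrix.sub_mulVec, Matrix.sub_mulVec, ← Matrix.mulVec_mulVec, hFu]
        simp [Matrix.smul_mulVec]
      rw [sub_smul, ← hev, h2]
      abel
    have := h.le_of_orthogonal u _ hu0 hSu hFu j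
    linarith
  have hq := hpsd.dotProduct_mulVec_nonneg v
  have hexp : v ⬝ᵥ N *ᵥ v = lam j * (v ⬝ᵥ v) - v ⬝ᵥ S *ᵥ v -
      ∑ i, (lam j - lam i) * (Fᵀ *ᵥ v) i ^ 2 := by
    rw [hN, Matrix.sub_mulVec, Matrix.sub_mulVec, dotProduct_sub, dotProduct_sub]
    congr 1
    · simp [Matrix.smul_mulVec]
    · rw [← Matrix.mulVec_mulVec, ← Matrix.mulVec_mulVec, Matrix.dotProduct_mulVec,
        ← Matrix.mulVec_transpose]
      simp only [dotProduct, hD, Matrix.mulVec_diagonal]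
      exact Finset.sum_congr rfl fun i _ => by ring
  have hnn : 0 ≤ ∑ i, (lam j - lam i) * (Fᵀ *ᵥ v) i ^ 2 := by
    refine Finset.sum_nonneg fun i _ => ?_
    rcases lt_or_ge i j with hij | hij
    · simp [hv i hij]
    · exact mul_nonneg (sub_nonneg.2 (h.antitone hij)) (sq_nonneg _)
  simp only [star_trivial] at hq
  linarith

/-- Weyl's inequality. -/
lemma eigenvalue_le (h : IsLeadingEigenpairs S F lam) (h' : IsLeadingEigenpairs S' F' lam')
    (hS' : S'ᵀ = S') (j : Fin r) : lam j ≤ lam' j + ‖S - S'‖ := by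
  -- A dimension count by determinant: rows `i < j` make `F c` orthogonal to the `i`-th column of
  -- `F'`, rows `i > j` force `c i = 0`, and row `j` is left zero, so a nonzero solution `c` exists.
  set M : Matrix (Fin r) (Fin r) ℝ := Matrix.of fun i =>
    if i < j then (F'ᵀ * F) i else if i = j then 0 else Pi.single i 1 with hM
  have hdet : M.det = 0 := Matrix.det_eq_zero_of_row_eq_zero j fun k => by simp [hM]
  obtain ⟨c, hc0, hc⟩ := Matrix.exists_mulVec_eq_zero_iff.2 hdet
  have hlow : ∀ i < j, (F'ᵀ *ᵥ (F *ᵥ c)) i = 0 := fun i hi => by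
    have hrow : M i = (F'ᵀ * F) i := by
      ext k
      simp [hM, hi]
    rw [Matrix.mulVec_mulVec]
    change (F'ᵀ * F) i ⬝ᵥ c = 0
    rw [← hrow]
    exact congrFun hc i
  have hhigh : ∀ i, j < i → c i = 0 := fun i hi => by
    have := congrFun hc i
    simpa [hM, Matrix.mulVec, hi.not_gt, hi.ne'] using this
  have hcc : 0 < c ⬝ᵥ c := by
    refine (dotProduct_self_nonneg_real c).lt_of_ne' ?_
    exact fun h0 => hc0 (dotProduct_self_eq_zero.1 h0)
  have hxx : (F *ᵥ c) ⬝ᵥ (F *ᵥ c) = c ⬝ᵥ c := by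
    rw [Matrix.dotProduct_mulVec, Matrix.vecMul_mulVec, h.orthonormal]
    simp
  have h1 := h'.rayleigh_le hS' j hlow
  have h2 : lam j * (c ⬝ᵥ c) ≤ (F *ᵥ c) ⬝ᵥ S *ᵥ (F *ᵥ c) := by
    rw [h.dotProduct_mulVec_eq, dotProduct, Finset.mul_sum]
    refine Finset.sum_le_sum fun i _ => ?_
    rcases le_or_gt i j with hij | hij
    · rw [← sq]
      exact mul_le_mul_of_nonneg_right (h.antitone hij) (sq_nonneg _)
    · simp [hhigh i hij]
  have h3 := (le_abs_self _).trans (abs_dotProduct_mulVec_self_le (S - S') (F *ᵥ c))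
  rw [Matrix.sub_mulVec, dotProduct_sub] at h3
  rw [hxx] at h1 h3
  have : lam j * (c ⬝ᵥ c) ≤ (lam' j + ‖S - S'‖) * (c ⬝ᵥ c) := by linarith
  exact le_of_mul_le_mul_right this hcc

lemma abs_eigenvalue_sub_le (h : IsLeadingEigenpairs S F lam)
    (h' : IsLeadingEigenpairs S' F' lam') (hS : Sᵀ = S) (hS' : S'ᵀ = S') (j : Fin r) :
    |lam j - lam' j| ≤ ‖S - S'‖ := by
  have h1 := h.eigenvalue_le h' hS' j
  have h2 := h'.eigenvalue_le h hS j
  rw [norm_sub_rev] at h2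
  exact abs_le.2 ⟨by linarith, by linarith⟩

end IsLeadingEigenpairs

end LinearAlgebra

/-! ### Perturbation of the dispersion matrix and of its leading eigenvectors. -/

section Perturbation

open scoped Matrix.Norms.L2Operator

lemma sampleMean_transpose {n T : ℕ} {M : ℕ → Matrix (Fin n) (Fin n) ℝ}
    (h : ∀ t, (M t)ᵀ = M t) : (sampleMean T M)ᵀ = sampleMean T M := by
  simp [sampleMean, Matrix.transpose_smul, Matrix.transpose_sum, h]

lemma sampleDispersion_transpose {n T : ℕ} {M : ℕ → Matrix (Fin n) (Fin n) ℝ}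
    (h : ∀ t, (M t)ᵀ = M t) : (sampleDispersion T M)ᵀ = sampleDispersion T M := by
  simp [sampleDispersion, Matrix.transpose_smul, Matrix.transpose_sum, Matrix.transpose_pow,
    Matrix.transpose_sub, sampleMean_transpose h, h]

lemma norm_sampleMean_le {n T : ℕ} {M : ℕ → Matrix (Fin n) (Fin n) ℝ} {c : ℝ} (hc : 0 ≤ c)
    (h : ∀ t ∈ Finset.Icc 1 T, ‖M t‖ ≤ c) : ‖sampleMean T M‖ ≤ c := by
  rcases Nat.eq_zero_or_pos T with rfl | hT
  · simpa [sampleMean] using hc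
  have hT' : (0 : ℝ) < T := by exact_mod_cast hT
  rw [sampleMean, norm_smul, Real.norm_of_nonneg (by positivity)]
  have := (norm_sum_le (Finset.Icc 1 T) M).trans (Finset.sum_le_sum h)
  simp only [Finset.sum_const, Nat.card_Icc, add_tsub_cancel_right, nsmul_eq_mul] at this
  calc (T : ℝ)⁻¹ * ‖∑ t ∈ Finset.Icc 1 T, M t‖ ≤ (T : ℝ)⁻¹ * (T * c) := by gcongr
    _ = c := by field_simp

lemma sampleMean_sub {n T : ℕ} (M N : ℕ → Matrix (Fin n) (Fin n) ℝ) :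
    sampleMean T (fun t => M t - N t) = sampleMean T M - sampleMean T N := by
  simp [sampleMean, Finset.sum_sub_distrib, smul_sub]

/-- Centring at most doubles the error, so the centred terms are `P` and `P + D` with `‖D‖ ≤ 2a`.
Then `(P + D)² - P² = PD + DP + D²` gives the constants. -/
lemma norm_sampleDispersion_sub_le {n T : ℕ} {M N : ℕ → Matrix (Fin n) (Fin n) ℝ} {a p : ℝ}
    (ha : 0 ≤ a) (hp : 0 ≤ p) (hMN : ∀ t ∈ Finset.Icc 1 T, ‖N t - M t‖ ≤ a)
    (hN : ∀ t ∈ Finset.Icc 1 T, ‖N t - sampleMean T N‖ ≤ p) :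
    ‖sampleDispersion T M - sampleDispersion T N‖ ≤ 4 * p * a + 4 * a ^ 2 := by
  have h : sampleDispersion T M - sampleDispersion T N = sampleMean T fun t =>
      (M t - sampleMean T M) ^ 2 - (N t - sampleMean T N) ^ 2 := by
    rw [sampleMean_sub]
    rfl
  rw [h]
  refine norm_sampleMean_le (by positivity) fun t ht => ?_
  set P := N t - sampleMean T N with hP
  set D := (M t - N t) - sampleMean T fun t => M t - N t with hD
  have hMP : M t - sampleMean T M = P + D := by
    rw [hP, hD, sampleMean_sub]
    abel
  have hMN' : ∀ t ∈ Finset.Icc 1 T, ‖M t - N t‖ ≤ a := fun t ht => by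
    rw [norm_sub_rev]
    exact hMN t ht
  have hDn : ‖D‖ ≤ 2 * a := by
    have h1 := norm_sub_le (M t - N t) (sampleMean T fun t => M t - N t)
    have h2 := norm_sampleMean_le ha hMN'
    linarith [hMN' t ht]
  have hexp : (P + D) ^ 2 - P ^ 2 = P * D + D * P + D * D := by noncomm_ring
  rw [hMP, hexp]
  have hPn := hN t ht
  have b1 : ‖P * D‖ ≤ p * (2 * a) :=
    (Matrix.l2_opNorm_mul _ _).trans (mul_le_mul hPn hDn (norm_nonneg _) hp)
  have b2 : ‖D * P‖ ≤ (2 * a) * p :=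
    (Matrix.l2_opNorm_mul _ _).trans (mul_le_mul hDn hPn (norm_nonneg _) (by positivity))
  have b3 : ‖D * D‖ ≤ (2 * a) * (2 * a) :=
    (Matrix.l2_opNorm_mul _ _).trans (mul_le_mul hDn hDn (norm_nonneg _) (by positivity))
  have b4 := norm_add_le (P * D + D * P) (D * D)
  have b5 := norm_add_le (P * D) (D * P)
  nlinarith

section Model

variable {n r T : ℕ} {Λ : Matrix (Fin n) (Fin r) ℝ} {Y₀ : Matrix (Fin n) (Fin n) ℝ}

/-- The static part `Y₀` equals its own mean and cancels. This needs `T ≠ 0`, as the empty mean is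
`0`. -/
lemma modelCov_sub_sampleMean (hT : T ≠ 0) (X : ℕ → Matrix (Fin r) (Fin r) ℝ) (t : ℕ) :
    modelCov Λ Y₀ (X t) - sampleMean T (fun t => modelCov Λ Y₀ (X t)) =
      Λ * (X t - sampleMean T X) * Λᵀ := by
  have hT' : (T : ℝ) ≠ 0 := by exact_mod_cast hT
  have h : sampleMean T (fun t => modelCov Λ Y₀ (X t)) = Λ * sampleMean T X * Λᵀ + Y₀ := by
    simp only [sampleMean, modelCov, Finset.sum_add_distrib, smul_add, Finset.sum_const,
      Nat.card_Icc, add_tsub_cancel_right]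
    rw [Matrix.mul_smul, Matrix.smul_mul, Matrix.mul_sum, Matrix.sum_mul,
      ← Nat.cast_smul_eq_nsmul ℝ, smul_smul, inv_mul_cancel₀ hT', one_smul]
  rw [h, modelCov, Matrix.mul_sub, Matrix.sub_mul]
  abel

/-- The inner factors `Λ'Λ` collapse in each square. This reduces an `n × n` spectral problem to one
of fixed size `r`. -/
lemma sampleDispersion_modelCov (hΛ : Λᵀ * Λ = 1) (X : ℕ → Matrix (Fin r) (Fin r) ℝ) :
    sampleDispersion T (fun t => modelCov Λ Y₀ (X t)) = Λ * sampleDispersion T X * Λᵀ := by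
  rcases eq_or_ne T 0 with rfl | hT
  · simp [sampleDispersion]
  simp only [sampleDispersion]
  rw [Matrix.mul_smul, Matrix.smul_mul, Matrix.mul_sum, Matrix.sum_mul]
  congr 1
  refine Finset.sum_congr rfl fun t _ => ?_
  rw [modelCov_sub_sampleMean hT]
  set Z := X t - sampleMean T X
  rw [sq, sq]
  calc Λ * Z * Λᵀ * (Λ * Z * Λᵀ) = Λ * Z * (Λᵀ * Λ) * Z * Λᵀ := by
        simp only [Matrix.mul_assoc]
    _ = Λ * (Z * Z) * Λᵀ := by rw [hΛ]; simp only [Matrix.mul_one, Matrix.mul_assoc]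

lemma norm_conj_le {V : Matrix (Fin r) (Fin r) ℝ} (hΛ : ‖Λ‖ ≤ 1) : ‖Λ * V * Λᵀ‖ ≤ ‖V‖ := by
  have h1 := Matrix.l2_opNorm_mul (Λ * V) Λᵀ
  have h2 := Matrix.l2_opNorm_mul Λ V
  rw [norm_transpose] at h1
  have h3 := norm_nonneg V
  have h4 := norm_nonneg Λ
  have h5 : ‖Λ‖ * ‖V‖ ≤ ‖V‖ := mul_le_of_le_one_left h3 hΛ
  calc _ ≤ ‖Λ * V‖ * ‖Λ‖ := h1
    _ ≤ ‖Λ * V‖ := mul_le_of_le_one_right (norm_nonneg _) hΛ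
    _ ≤ _ := h2.trans h5

/-- A vector orthogonal to `Λ Q` is killed by `Λ'`, because `Q` is orthogonal, so its eigenvalue is
`0 ≤ v j`. This supplies the comparison matrix `Λ V Λ'`, whose leading eigenvalues `v` do not depend
on `n`. -/
lemma isLeadingEigenpairs_conj (hΛ : Λᵀ * Λ = 1) {V Q : Matrix (Fin r) (Fin r) ℝ}
    {v : Fin r → ℝ} (hQ : Qᵀ * Q = 1) (hv : Antitone v) (hVQ : V * Q = Q * Matrix.diagonal v)
    (hpos : ∀ j, 0 ≤ v j) : IsLeadingEigenpairs (Λ * V * Λᵀ) (Λ * Q) v where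
  orthonormal := by
    rw [Matrix.transpose_mul]
    calc Qᵀ * Λᵀ * (Λ * Q) = Qᵀ * (Λᵀ * Λ) * Q := by simp only [Matrix.mul_assoc]
      _ = 1 := by rw [hΛ, Matrix.mul_one, hQ]
  antitone := hv
  mul_eq := by
    calc Λ * V * Λᵀ * (Λ * Q) = Λ * V * (Λᵀ * Λ) * Q := by simp only [Matrix.mul_assoc]
      _ = Λ * Q * Matrix.diagonal v := by
        rw [hΛ, Matrix.mul_one, Matrix.mul_assoc, hVQ, Matrix.mul_assoc]
  le_of_orthogonal := fun u κ hu hSu hFu j => by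
    have h1 : Λᵀ *ᵥ u = 0 := by
      have hQQ : Q * Qᵀ = 1 := mul_eq_one_comm.1 hQ
      calc Λᵀ *ᵥ u = (Q * Qᵀ) *ᵥ Λᵀ *ᵥ u := by rw [hQQ, Matrix.one_mulVec]
        _ = Q *ᵥ ((Λ * Q)ᵀ *ᵥ u) := by
          simp only [Matrix.transpose_mul, Matrix.mulVec_mulVec, Matrix.mul_assoc]
        _ = 0 := by rw [hFu, Matrix.mulVec_zero]
    have h2 : κ • u = 0 := by
      rw [← hSu, ← Matrix.mulVec_mulVec, h1, Matrix.mulVec_zero]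
    rw [(smul_eq_zero.1 h2).resolve_right hu]
    exact hpos j

/-- If `S` has the form `Λ V Λ'` and `r` nonzero leading eigenvalues, the leading eigenvectors
span its range. -/
lemma IsLeadingEigenpairs.mul_mul_transpose (hΛ : Λᵀ * Λ = 1) {V : Matrix (Fin r) (Fin r) ℝ}
    {F : Matrix (Fin n) (Fin r) ℝ} {lam : Fin r → ℝ}
    (h : IsLeadingEigenpairs (Λ * V * Λᵀ) F lam) (hlam : ∀ j, lam j ≠ 0) :
    Λ * V * Λᵀ * F * Fᵀ = Λ * V * Λᵀ := by
  -- Dividing `S F = F diag(lam)` by the eigenvalues shows `F = Λ R`. Since `R` is square with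
  -- orthonormal columns, `F F' = Λ Λ'`.
  set R : Matrix (Fin r) (Fin r) ℝ := V * Λᵀ * F * Matrix.diagonal fun j => (lam j)⁻¹ with hR
  have hFR : F = Λ * R := by
    have h1 : F * Matrix.diagonal lam * Matrix.diagonal (fun j => (lam j)⁻¹) = F := by
      rw [Matrix.mul_assoc, Matrix.diagonal_mul_diagonal]
      simp [hlam]
    rw [← h.mul_eq] at h1
    rw [hR]
    simpa only [Matrix.mul_assoc] using h1.symm
  have hRR : Rᵀ * R = 1 := by
    have h1 := h.orthonormal
    rw [hFR, Matrix.transpose_mul] at h1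
    calc Rᵀ * R = Rᵀ * (Λᵀ * Λ) * R := by rw [hΛ, Matrix.mul_one]
      _ = 1 := by rw [← h1]; simp only [Matrix.mul_assoc]
  have hRR' : R * Rᵀ = 1 := mul_eq_one_comm.1 hRR
  have hFF : F * Fᵀ = Λ * Λᵀ := by
    rw [hFR, Matrix.transpose_mul]
    calc Λ * R * (Rᵀ * Λᵀ) = Λ * (R * Rᵀ) * Λᵀ := by simp only [Matrix.mul_assoc]
      _ = _ := by rw [hRR', Matrix.mul_one]
  calc Λ * V * Λᵀ * F * Fᵀ = Λ * V * Λᵀ * (F * Fᵀ) := by simp only [Matrix.mul_assoc]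
    _ = Λ * V * (Λᵀ * Λ) * Λᵀ := by rw [hFF]; simp only [Matrix.mul_assoc]
    _ = Λ * V * Λᵀ := by rw [hΛ, Matrix.mul_one]

end Model

/-- Davis–Kahan type bound for individual leading eigenvectors with matching signs. -/
lemma abs_transpose_mul_sub_one_le {n r : ℕ} {S S' : Matrix (Fin n) (Fin n) ℝ}
    {F F' : Matrix (Fin n) (Fin r) ℝ} {lam lam' : Fin r → ℝ}
    (h : IsLeadingEigenpairs S F lam) (h' : IsLeadingEigenpairs S' F' lam')
    (hS : Sᵀ = S) (hSF : S * F * Fᵀ = S) {ε d : ℝ} (hd : 0 < d) (hεd : ε ≤ d)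
    (hε : ‖S' - S‖ ≤ ε) (hgap : ∀ i j, i ≠ j → d ≤ |lam' j - lam i|) (hpos : ∀ j, d ≤ lam' j)
    (hsign : ∀ j, 0 ≤ (Fᵀ * F') j j) (i j : Fin r) :
    |(Fᵀ * F' - (1 : Matrix (Fin r) (Fin r) ℝ)) i j| ≤ (r + 1) * (ε / d) := by
  have hε0 : 0 ≤ ε := (norm_nonneg _).trans hε
  have hεd0 : 0 ≤ ε / d := by positivity
  have hεd1 : ε / d ≤ 1 := (div_le_one hd).2 hεd
  have hF1 : ‖Fᵀ‖ ≤ 1 := by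
    rw [norm_transpose]
    exact norm_le_one_of_transpose_mul_self h.orthonormal
  have hF1' : ‖F'‖ ≤ 1 := norm_le_one_of_transpose_mul_self h'.orthonormal
  have hoff (i j : Fin r) (hij : i ≠ j) : |(Fᵀ * F') i j| ≤ ε / d := by
    have hFS : Fᵀ * S = Matrix.diagonal lam * Fᵀ := by
      have := congrArg Matrix.transpose h.mul_eq
      rwa [Matrix.transpose_mul, Matrix.transpose_mul, hS, Matrix.diagonal_transpose] at this
    -- `S'` acts on the right through `lam'` and `S` on the left through `lam`; the gap then allows
    -- division.
    have h1 : (Fᵀ * (S' - S) * F') i j = (lam' j - lam i) * (Fᵀ * F') i j := by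
      rw [Matrix.mul_sub, Matrix.sub_mul, Matrix.mul_assoc, h'.mul_eq, hFS, ← Matrix.mul_assoc,
        Matrix.mul_assoc (Matrix.diagonal lam), Matrix.sub_apply, Matrix.mul_diagonal,
        Matrix.diagonal_mul]
      ring
    have h2 : |(Fᵀ * (S' - S) * F') i j| ≤ ε := by
      refine (abs_entry_le_norm _ i j).trans ?_
      refine (Matrix.l2_opNorm_mul _ _).trans ?_
      refine (mul_le_of_le_one_right (norm_nonneg _) hF1').trans ?_
      refine (Matrix.l2_opNorm_mul _ _).trans ?_
      exact (mul_le_of_le_one_left (norm_nonneg _) hF1).trans hε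
    rw [h1, abs_mul] at h2
    rw [le_div_iff₀ hd, mul_comm]
    exact (mul_le_mul_of_nonneg_right (hgap i j hij) (abs_nonneg _)).trans h2
  rcases ne_or_eq i j with hij | rfl
  · rw [Matrix.sub_apply, Matrix.one_apply_ne hij, sub_zero]
    refine (hoff i j hij).trans ?_
    nlinarith [(Nat.cast_nonneg r : (0 : ℝ) ≤ r)]
  set u : Fin n → ℝ := F'.col i with hu
  -- The component of `u` off the span of `F`. As `S` kills it, `w'(S' - S)u = lam' i · ‖w‖²`, hence
  -- `‖w‖ ≤ ε / d`.
  set w : Fin n → ℝ := u - F *ᵥ (Fᵀ *ᵥ u) with hw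
  have huu : u ⬝ᵥ u = 1 := by
    have := congrFun (congrFun h'.orthonormal i) i
    rw [Matrix.one_apply_eq] at this
    rw [← this]
    rfl
  have hFw : Fᵀ *ᵥ w = 0 := by
    rw [hw, Matrix.mulVec_sub, Matrix.mulVec_mulVec _ Fᵀ F, h.orthonormal, Matrix.one_mulVec,
      sub_self]
  have hSw : S *ᵥ w = 0 := by
    rw [hw, Matrix.mulVec_sub, Matrix.mulVec_mulVec, Matrix.mulVec_mulVec, hSF, sub_self]
  have hFF : (F *ᵥ (Fᵀ *ᵥ u)) ⬝ᵥ u = (Fᵀ *ᵥ u) ⬝ᵥ (Fᵀ *ᵥ u) := by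
    rw [dotProduct_comm, Matrix.dotProduct_mulVec, ← Matrix.mulVec_transpose]
  have hwF : w ⬝ᵥ (F *ᵥ (Fᵀ *ᵥ u)) = 0 := by
    rw [Matrix.dotProduct_mulVec, ← Matrix.mulVec_transpose, hFw, zero_dotProduct]
  have hwu : w ⬝ᵥ u = w ⬝ᵥ w := by
    nth_rw 3 [hw]
    rw [dotProduct_sub, hwF, sub_zero]
  have hpyth : w ⬝ᵥ w + (Fᵀ *ᵥ u) ⬝ᵥ (Fᵀ *ᵥ u) = 1 := by
    rw [← hwu, hw, sub_dotProduct, hFF, huu]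
    ring
  have hwΔ : w ⬝ᵥ (S' - S) *ᵥ u = lam' i * (w ⬝ᵥ w) := by
    have h2 : w ⬝ᵥ S *ᵥ u = 0 := by
      rw [Matrix.dotProduct_mulVec, ← Matrix.mulVec_transpose, hS, hSw, zero_dotProduct]
    rw [Matrix.sub_mulVec, dotProduct_sub, h2, h'.mulVec_col i, dotProduct_smul, hwu]
    simp
  have hww0 := dotProduct_self_nonneg_real w
  have hww : w ⬝ᵥ w ≤ (ε / d) ^ 2 := by
    have h2 := dotProduct_mulVec_sq_le (S' - S) w u
    rw [hwΔ, huu, mul_one] at h2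
    have h3 : ‖S' - S‖ ^ 2 ≤ ε ^ 2 := pow_le_pow_left₀ (norm_nonneg _) hε 2
    have h4 : d ^ 2 ≤ lam' i ^ 2 := pow_le_pow_left₀ hd.le (hpos i) 2
    rcases hww0.eq_or_lt with h0 | h0
    · rw [← h0]; positivity
    have h5 : d ^ 2 * (w ⬝ᵥ w) * (w ⬝ᵥ w) ≤ ε ^ 2 * (w ⬝ᵥ w) :=
      calc d ^ 2 * (w ⬝ᵥ w) * (w ⬝ᵥ w) ≤ lam' i ^ 2 * (w ⬝ᵥ w) * (w ⬝ᵥ w) := by gcongr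
        _ = (lam' i * (w ⬝ᵥ w)) ^ 2 := by ring
        _ ≤ ‖S' - S‖ ^ 2 * (w ⬝ᵥ w) := h2
        _ ≤ ε ^ 2 * (w ⬝ᵥ w) := by gcongr
    have h6 := le_of_mul_le_mul_right h5 h0
    rw [div_pow, le_div_iff₀ (by positivity)]
    linarith
  have hsum : (Fᵀ *ᵥ u) ⬝ᵥ (Fᵀ *ᵥ u) ≤ (Fᵀ * F') i i ^ 2 + r * (ε / d) ^ 2 := by
    have h1 : (Fᵀ *ᵥ u) ⬝ᵥ (Fᵀ *ᵥ u) = ∑ k, (Fᵀ * F') k i ^ 2 := by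
      simp only [dotProduct, ← sq]
      rfl
    rw [h1, ← Finset.add_sum_erase _ _ (Finset.mem_univ i)]
    gcongr
    have h2 : ∀ k ∈ Finset.univ.erase i, (Fᵀ * F') k i ^ 2 ≤ (ε / d) ^ 2 := fun k hk => by
      rw [← sq_abs]
      exact pow_le_pow_left₀ (abs_nonneg _) (hoff k i (Finset.ne_of_mem_erase hk)) 2
    refine (Finset.sum_le_card_nsmul _ _ _ h2).trans ?_
    rw [nsmul_eq_mul]
    gcongr
    exact (Finset.card_le_univ _).trans_eq (by simp)
  set c := (Fᵀ * F') i i with hc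
  have hc0 : 0 ≤ c := hsign i
  have hq0 : 0 ≤ (Fᵀ *ᵥ u) ⬝ᵥ (Fᵀ *ᵥ u) := dotProduct_self_nonneg_real _
  have hc1 : c ≤ 1 := by
    have h1 : c ^ 2 ≤ (Fᵀ *ᵥ u) ⬝ᵥ (Fᵀ *ᵥ u) := by
      rw [dotProduct, sq]
      exact Finset.single_le_sum (f := fun k => (Fᵀ *ᵥ u) k * (Fᵀ *ᵥ u) k)
        (fun k _ => mul_self_nonneg _) (Finset.mem_univ i)
    nlinarith
  rw [Matrix.sub_apply, Matrix.one_apply_eq, abs_sub_comm, abs_of_nonneg (by linarith)]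
  -- Pythagoras bounds `1 - c²`, and `1 - c ≤ 1 - c²` for `0 ≤ c ≤ 1`; the sign condition enters
  -- here.
  have h7 : 1 - c ≤ (r + 1) * (ε / d) ^ 2 := by nlinarith
  refine h7.trans ?_
  gcongr
  exact pow_le_of_le_one hεd0 hεd1 two_ne_zero

end Perturbation

/-! ### Deterministic bounds for the estimated eigenvectors and factor covariances. -/

section Deterministic

open scoped Matrix.Norms.L2Operator

lemma norm_modelCov_le {n r : ℕ} {Λ : Matrix (Fin n) (Fin r) ℝ} {Y₀ : Matrix (Fin n) (Fin n) ℝ}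
    (hΛ : Λᵀ * Λ = 1) (X : Matrix (Fin r) (Fin r) ℝ) : ‖modelCov Λ Y₀ X‖ ≤ ‖X‖ + ‖Y₀‖ :=
  (norm_add_le _ _).trans
    (add_le_add_left (norm_conj_le (norm_le_one_of_transpose_mul_self hΛ)) _)

/-- The sample eigenvectors are close to those of the model as soon as the dispersion of the
factors has a spectral gap. -/
lemma abs_transpose_mul_sub_one_le_of_sample {n r T : ℕ} (hT : T ≠ 0)
    {Λ : Matrix (Fin n) (Fin r) ℝ} {Y₀ : Matrix (Fin n) (Fin n) ℝ} (hΛ : Λᵀ * Λ = 1)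
    (hY₀ : Y₀ᵀ = Y₀) {X : ℕ → Matrix (Fin r) (Fin r) ℝ} (hX : ∀ t, (X t)ᵀ = X t)
    {Y : ℕ → Matrix (Fin n) (Fin n) ℝ} (hY : ∀ t, (Y t)ᵀ = Y t)
    {V Q : Matrix (Fin r) (Fin r) ℝ} {v : Fin r → ℝ} {g : ℝ} (hV : Vᵀ = V)
    (hQ : Qᵀ * Q = 1) (hv : Antitone v) (hVQ : V * Q = Q * Matrix.diagonal v) (hg : 0 < g)
    (hgv : ∀ j, g ≤ v j) (hgap : ∀ i j, i ≠ j → g ≤ |v i - v j|) {a b : ℝ} (ha : 0 ≤ a)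
    (hb : 0 ≤ b) (hXb : ∀ t ∈ Finset.Icc 1 T, ∀ i j, |X t i j| ≤ b)
    (hYa : ∀ t ∈ Finset.Icc 1 T, ‖modelCov Λ Y₀ (X t) - Y t‖ ≤ a)
    (hXV : ‖sampleDispersion T X - V‖ ≤ g / 4)
    (hε : 8 * unitNormSum r * b * a + 4 * a ^ 2 ≤ g / 4) {F F' : Matrix (Fin n) (Fin r) ℝ}
    (hF : IsLeadingEigenvectors (sampleDispersion T fun t => modelCov Λ Y₀ (X t)) F)
    (hF' : IsLeadingEigenvectors (sampleDispersion T Y) F')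
    (hsign : ∀ j, 0 ≤ (Fᵀ * F') j j) (i j : Fin r) :
    |(Fᵀ * F' - (1 : Matrix (Fin r) (Fin r) ℝ)) i j| ≤
      (r + 1) * ((8 * unitNormSum r * b * a + 4 * a ^ 2) / (g / 4)) := by
  obtain ⟨lam, h⟩ := hF.exists_eigenpairs
  obtain ⟨lam', h'⟩ := hF'.exists_eigenpairs
  have hΛ1 := norm_le_one_of_transpose_mul_self hΛ
  have hκ := unitNormSum_nonneg r
  have hmodel (t : ℕ) : (modelCov Λ Y₀ (X t))ᵀ = modelCov Λ Y₀ (X t) := by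
    simp [modelCov, Matrix.transpose_mul, hX, hY₀, Matrix.mul_assoc]
  have hS := sampleDispersion_transpose (T := T) hmodel
  have hS' := sampleDispersion_transpose (T := T) hY
  have hΔ : ‖sampleDispersion T Y - sampleDispersion T fun t => modelCov Λ Y₀ (X t)‖ ≤
      8 * unitNormSum r * b * a + 4 * a ^ 2 := by
    have hXn : ∀ t ∈ Finset.Icc 1 T, ‖X t‖ ≤ unitNormSum r * b := fun t ht =>
      norm_le_unitNormSum_mul (hXb t ht)
    have hm := norm_sampleMean_le (mul_nonneg hκ hb) hXn
    have := norm_sampleDispersion_sub_le (p := 2 * (unitNormSum r * b)) ha (by positivity) hYa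
      fun t ht => by
        rw [modelCov_sub_sampleMean hT]
        refine (norm_conj_le hΛ1).trans ((norm_sub_le _ _).trans ?_)
        linarith [hXn t ht]
    linarith
  rw [sampleDispersion_modelCov hΛ] at h hS hΔ
  have hpop := isLeadingEigenpairs_conj hΛ hQ hv hVQ fun j => hg.le.trans (hgv j)
  have hpopt : (Λ * V * Λᵀ)ᵀ = Λ * V * Λᵀ := by
    simp [Matrix.transpose_mul, hV, Matrix.mul_assoc]
  -- Weyl against the comparison matrix `Λ V Λ'`, where conjugation by `Λ` does not increase the
  -- norm.
  have hlam (j : Fin r) : |lam j - v j| ≤ g / 4 := by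
    refine (h.abs_eigenvalue_sub_le hpop hS hpopt j).trans ?_
    rw [← Matrix.sub_mul, ← Matrix.mul_sub]
    exact (norm_conj_le hΛ1).trans hXV
  have hlam' (j : Fin r) : |lam' j - lam j| ≤ g / 4 :=
    (h'.abs_eigenvalue_sub_le h hS' hS j).trans (hΔ.trans hε)
  have hlam0 (j : Fin r) : lam j ≠ 0 := by
    have h1 := abs_le.1 (hlam j)
    have h2 := hgv j
    intro h0
    rw [h0] at h1
    linarith [h1.1]
  -- Here `d = g / 4`: three eigenvalue perturbations of at most `g / 4` are taken from the gap `g`,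
  -- and two from the lower bound.
  refine abs_transpose_mul_sub_one_le h h' hS (h.mul_mul_transpose hΛ hlam0) (by linarith) hε hΔ
    (fun i j hij => ?_) (fun j => ?_) hsign i j
  · have h1 := hgap j i hij.symm
    have h2 := hlam i
    have h3 := hlam j
    have h4 := hlam' j
    have h5 : |v j - v i| ≤ |lam' j - lam i| + |lam' j - lam j| + |lam j - v j| +
        |lam i - v i| := by
      have e : v j - v i = (lam' j - lam i) + (-(lam' j - lam j)) + (-(lam j - v j)) +
        (lam i - v i) := by ring
      rw [e]
      refine (abs_add_le _ _).trans (add_le_add_left ((abs_add_le _ _).trans ?_) _)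
      rw [abs_neg]
      refine add_le_add_left ((abs_add_le _ _).trans ?_) _
      rw [abs_neg]
    linarith
  · have h1 := abs_le.1 (hlam j)
    have h2 := abs_le.1 (hlam' j)
    have h3 := hgv j
    linarith [h1.1, h2.1]

/-- With orthonormal columns, `(F' - F)ᵀ(F' - F) = -(W + Wᵀ)` for `W = Fᵀ F' - 1`. The squared
distance is linear in `W`, which is the source of the exponent `1/2` on `A` in (ii). -/
lemma norm_sub_le_sqrt_of_entries {n r : ℕ} {F F' : Matrix (Fin n) (Fin r) ℝ}
    (hF : Fᵀ * F = 1) (hF' : F'ᵀ * F' = 1) {θ : ℝ}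
    (hθ : ∀ i j, |(Fᵀ * F' - (1 : Matrix (Fin r) (Fin r) ℝ)) i j| ≤ θ) :
    ‖F' - F‖ ≤ √(2 * unitNormSum r * θ) := by
  refine Real.le_sqrt_of_sq_le ?_
  set W := Fᵀ * F' - (1 : Matrix (Fin r) (Fin r) ℝ) with hW
  have h1 : (F' - F)ᵀ * (F' - F) = -(W + Wᵀ) := by
    rw [hW, Matrix.transpose_sub, Matrix.sub_mul, Matrix.mul_sub, Matrix.mul_sub, hF, hF',
      Matrix.transpose_sub, Matrix.transpose_mul, Matrix.transpose_transpose,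
      Matrix.transpose_one]
    abel
  have h2 := norm_transpose_mul_self (F' - F)
  rw [h1, norm_neg] at h2
  have h3 := norm_add_le W Wᵀ
  rw [norm_transpose] at h3
  have h4 := norm_le_unitNormSum_mul hθ
  nlinarith

/-- The target is `Fᵀ M F` with `M` the model covariance, so the difference telescopes: replace `Y`
by `M`, then `F'` by `F` one side at a time. -/
lemma norm_estFactorCov_sub_factorCov_le {n r : ℕ} {Λ : Matrix (Fin n) (Fin r) ℝ}
    {Y₀ Y : Matrix (Fin n) (Fin n) ℝ} {X : Matrix (Fin r) (Fin r) ℝ}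
    {F F' : Matrix (Fin n) (Fin r) ℝ} (hF : Fᵀ * F = 1) (hF' : F'ᵀ * F' = 1) :
    ‖estFactorCov F' Y - factorCov Λ F Y₀ X‖ ≤
      ‖modelCov Λ Y₀ X - Y‖ + 2 * ‖F' - F‖ * ‖modelCov Λ Y₀ X‖ := by
  set M := modelCov Λ Y₀ X with hM
  have hfac : factorCov Λ F Y₀ X = Fᵀ * M * F := by
    simp only [factorCov, hM, modelCov, Matrix.transpose_mul, Matrix.transpose_transpose,
      Matrix.mul_add, Matrix.add_mul, Matrix.mul_assoc]
  have hexp : estFactorCov F' Y - factorCov Λ F Y₀ X =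
      F'ᵀ * (Y - M) * F' + ((F' - F)ᵀ * M * F' + Fᵀ * M * (F' - F)) := by
    rw [hfac, estFactorCov]
    simp only [Matrix.transpose_sub, Matrix.mul_sub, Matrix.sub_mul]
    abel
  have n1 := norm_le_one_of_transpose_mul_self hF
  have n2 := norm_le_one_of_transpose_mul_self hF'
  have hmul3 (A B : Matrix (Fin n) (Fin r) ℝ) (N : Matrix (Fin n) (Fin n) ℝ) :
      ‖Aᵀ * N * B‖ ≤ ‖A‖ * ‖N‖ * ‖B‖ := by
    refine (Matrix.l2_opNorm_mul _ _).trans ?_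
    refine mul_le_mul_of_nonneg_right ((Matrix.l2_opNorm_mul _ _).trans_eq ?_) (norm_nonneg _)
    rw [norm_transpose]
  have b1 : ‖F'ᵀ * (Y - M) * F'‖ ≤ ‖M - Y‖ := by
    refine (hmul3 F' F' (Y - M)).trans ?_
    rw [norm_sub_rev Y M]
    refine (mul_le_of_le_one_right (by positivity) n2).trans ?_
    exact mul_le_of_le_one_left (norm_nonneg _) n2
  have b2 : ‖(F' - F)ᵀ * M * F'‖ ≤ ‖F' - F‖ * ‖M‖ :=
    (hmul3 _ _ _).trans (mul_le_of_le_one_right (by positivity) n2)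
  have b3 : ‖Fᵀ * M * (F' - F)‖ ≤ ‖F' - F‖ * ‖M‖ := by
    refine (hmul3 _ _ _).trans ?_
    rw [mul_comm]
    exact mul_le_mul_of_nonneg_left (mul_le_of_le_one_left (norm_nonneg _) n1) (norm_nonneg _)
  rw [hexp]
  have b4 := norm_add_le (F'ᵀ * (Y - M) * F') ((F' - F)ᵀ * M * F' + Fᵀ * M * (F' - F))
  have b5 := norm_add_le ((F' - F)ᵀ * M * F') (Fᵀ * M * (F' - F))
  linarith

lemma frobNorm_le_mul_norm {r : ℕ} (M : Matrix (Fin r) (Fin r) ℝ) : frobNorm M ≤ r * ‖M‖ :=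
  frobNorm_le (norm_nonneg _) (abs_entry_le_norm M)

lemma frobNorm_nonneg {a b : ℕ} (M : Matrix (Fin a) (Fin b) ℝ) : 0 ≤ frobNorm M :=
  Real.sqrt_nonneg _

/-- The entries of a positive definite matrix are dominated by its diagonal. -/
lemma abs_entry_le_of_posDef {r : ℕ} {M : Matrix (Fin r) (Fin r) ℝ} (hM : M.PosDef) {b : ℝ}
    (hb : ∀ i, |M i i| ≤ b) (i j : Fin r) : |M i j| ≤ b := by
  have hsym : M j i = M i j := by
    have := hM.isHermitian.apply i j
    simpa using this
  have hi := (abs_le.1 (hb i)).2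
  have hj := (abs_le.1 (hb j)).2
  -- Testing with `e_i ± e_j` gives `2|M i j| ≤ M i i + M j j`.
  have hq (s : ℝ) (hs : s ^ 2 = 1) : 0 ≤ M i i + 2 * s * M i j + M j j := by
    have h := hM.posSemidef.dotProduct_mulVec_nonneg (Pi.single i 1 + s • Pi.single j 1)
    simp only [star_trivial, Matrix.mulVec_add, Matrix.mulVec_smul, Matrix.mulVec_single_one,
      add_dotProduct, smul_dotProduct, dotProduct_add, dotProduct_smul,
      single_one_dotProduct, Matrix.col_apply, smul_eq_mul, hsym] at h
    have hss : s * (s * M j j) = M j j := by rw [← mul_assoc, ← sq, hs, one_mul]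
    rw [mul_add, hss] at h
    linarith
  have h1 := hq 1 (by norm_num)
  have h2 := hq (-1) (by norm_num)
  exact abs_le.2 ⟨by linarith, by linarith⟩

lemma exists_pos_le_of_finite {ι : Type*} [Finite ι] {f : ι → ℝ} (hf : ∀ i, 0 < f i) :
    ∃ g, 0 < g ∧ ∀ i, g ≤ f i := by
  cases isEmpty_or_nonempty ι
  · exact ⟨1, one_pos, fun i => isEmptyElim i⟩
  · obtain ⟨i, hi⟩ := Finite.exists_min f
    exact ⟨f i, hf i, hi⟩

lemma HasSimplePositiveSpectrum.exists_sorted {r : ℕ} {V : Matrix (Fin r) (Fin r) ℝ}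
    (h : HasSimplePositiveSpectrum V) :
    Vᵀ = V ∧ ∃ (Q : Matrix (Fin r) (Fin r) ℝ) (v : Fin r → ℝ) (g : ℝ),
      Qᵀ * Q = 1 ∧ Antitone v ∧ V * Q = Q * Matrix.diagonal v ∧ 0 < g ∧ (∀ j, g ≤ v j) ∧
        ∀ i j, i ≠ j → g ≤ |v i - v j| := by
  obtain ⟨hpd, hinj⟩ := h
  have hH := hpd.isHermitian
  refine ⟨by simpa [Matrix.IsHermitian] using hH, ?_⟩
  -- The sort is increasing, so the eigenvalues are negated to get decreasing order.
  set σ := Tuple.sort (-hH.eigenvalues) with hσ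
  set v : Fin r → ℝ := hH.eigenvalues ∘ σ with hv
  set Q : Matrix (Fin r) (Fin r) ℝ := Matrix.of fun i j => hH.eigenvectorBasis (σ j) i with hQ
  have hvpos (j : Fin r) : 0 < v j := hpd.eigenvalues_pos _
  have hvinj : Function.Injective v := hinj.comp σ.injective
  obtain ⟨g₁, hg₁, hg₁v⟩ := exists_pos_le_of_finite hvpos
  obtain ⟨g₂, hg₂, hg₂v⟩ := exists_pos_le_of_finite
    (f := fun p : {p : Fin r × Fin r // p.1 ≠ p.2} => |v p.1.1 - v p.1.2|)
    fun p => abs_pos.2 (sub_ne_zero.2 (hvinj.ne p.2))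
  refine ⟨Q, v, min g₁ g₂, ?_, ?_, ?_, lt_min hg₁ hg₂, fun j => (min_le_left _ _).trans (hg₁v j),
    fun i j hij => (min_le_right _ _).trans (hg₂v ⟨(i, j), hij⟩)⟩
  · ext i j
    have h1 := (orthonormal_iff_ite.1 hH.eigenvectorBasis.orthonormal) (σ i) (σ j)
    rw [PiLp.inner_apply] at h1
    simp only [Matrix.mul_apply, Matrix.transpose_apply, hQ, Matrix.of_apply, Matrix.one_apply]
    simpa [mul_comm, σ.injective.eq_iff] using h1
  · intro i j hij
    have := Tuple.monotone_sort (-hH.eigenvalues) hij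
    simpa [hv] using this
  · ext i j
    have h1 := congrFun (hH.mulVec_eigenvectorBasis (σ j)) i
    rw [Matrix.mul_diagonal]
    simpa [hQ, hv, Matrix.mul_apply, Matrix.mulVec, dotProduct, mul_comm] using h1

end Deterministic

/-! ### Maxima over the sample period. -/

section MaxUpTo

lemma le_maxUpTo {T : ℕ} {f : ℕ → ℝ} {t : ℕ} (ht : t ∈ Finset.Icc 1 T) : f t ≤ maxUpTo T f :=
  le_ciSup (f := fun t : Finset.Icc 1 T => f t) (Set.finite_range _).bddAbove ⟨t, ht⟩

lemma maxUpTo_le {T : ℕ} {f : ℕ → ℝ} {c : ℝ} (hc : 0 ≤ c) (h : ∀ t ∈ Finset.Icc 1 T, f t ≤ c) :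
    maxUpTo T f ≤ c :=
  Real.iSup_le (fun t => h t t.2) hc

lemma maxUpTo_nonneg {T : ℕ} {f : ℕ → ℝ} (h : ∀ t, 0 ≤ f t) : 0 ≤ maxUpTo T f :=
  Real.iSup_nonneg fun t => h t

end MaxUpTo

/-! ### Convergence in probability of the sample dispersion of the factors. -/

section LawOfLargeNumbers

variable {Ω : Type*} [MeasurableSpace Ω] {μ : Measure Ω} [IsProbabilityMeasure μ] {r : ℕ}
  {X : ℕ → Ω → Matrix (Fin r) (Fin r) ℝ}

/-- Weak law of large numbers for functions of a stationary ergodic matrix process. -/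
lemma IsStationaryErgodic.tendsto_measure_average (hX : IsStationaryErgodic μ X)
    {G : (Fin r → Fin r → ℝ) → ℝ} (hG : Measurable G)
    (hi : Integrable (fun ω => G fun i j => X 1 ω i j) μ) {δ : ℝ} (hδ : 0 < δ) :
    Tendsto (fun T : ℕ => μ {ω | δ ≤ |(T : ℝ)⁻¹ * ∑ t ∈ Finset.Icc 1 T, G (fun i j => X t ω i j) -
      ∫ ω, G (fun i j => X 1 ω i j) ∂μ|}) atTop (𝓝 0) := by
  obtain ⟨hmeas, herg⟩ := hX
  set φ : Ω → ℕ → Fin r → Fin r → ℝ := fun ω t i j => X t ω i j with hφ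
  set S : (ℕ → Fin r → Fin r → ℝ) → ℕ → Fin r → Fin r → ℝ := fun x t => x (t + 1) with hS
  have hφm : Measurable φ := by
    refine measurable_pi_lambda _ fun t => measurable_pi_lambda _ fun i =>
      measurable_pi_lambda _ fun j => hmeas t i j
  have : IsProbabilityMeasure (μ.map φ) := Measure.isProbabilityMeasure_map hφm.aemeasurable
  -- Reading coordinate `1` rather than `0` turns the orbit times `0, …, T - 1` into the sample
  -- times `1, …, T`.
  set f : (ℕ → Fin r → Fin r → ℝ) → ℝ := fun x => G (x 1) with hf
  have hfm : Measurable f := hG.comp (measurable_pi_apply 1)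
  have hfi : Integrable f (μ.map φ) :=
    (integrable_map_measure hfm.aestronglyMeasurable hφm.aemeasurable).2 hi
  have hint : ∫ x, f x ∂(μ.map φ) = ∫ ω, G (fun i j => X 1 ω i j) ∂μ :=
    integral_map hφm.aemeasurable hfm.aestronglyMeasurable
  have hlim := tendstoInMeasure_of_tendsto_eLpNorm (g := fun _ => ∫ x, f x ∂(μ.map φ)) one_ne_zero
    (aestronglyMeasurable_birkhoffAverage herg.toMeasurePreserving hfi.1)
    aestronglyMeasurable_const (tendsto_eLpNorm_birkhoffAverage herg hfi)
  have hlim' := (tendstoInMeasure_iff_norm.1 hlim) δ hδ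
  refine tendsto_of_tendsto_of_tendsto_of_le_of_le tendsto_const_nhds hlim' (fun _ => zero_le)
    fun T => ?_
  refine le_trans (measure_mono ?_) (Measure.le_map_apply hφm.aemeasurable _)
  intro ω hω
  have hit (k t : ℕ) (x : ℕ → Fin r → Fin r → ℝ) : S^[k] x t = x (t + k) := by
    induction k generalizing t with
    | zero => rfl
    | succ k ih =>
      rw [Function.iterate_succ_apply', hS]
      change S^[k] x (t + 1) = _
      rw [ih]
      congr 1
      ring
  have havg : birkhoffAverage ℝ S f T (φ ω) =
      (T : ℝ)⁻¹ * ∑ t ∈ Finset.Icc 1 T, G (fun i j => X t ω i j) := by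
    simp only [birkhoffAverage, birkhoffSum, smul_eq_mul, hf, hit]
    rw [Finset.range_eq_Ico, Finset.sum_Ico_add (fun t => G (φ ω t)) 0 T 1]
    congr 2
  change δ ≤ ‖birkhoffAverage ℝ S f T (φ ω) - ∫ x, f x ∂(μ.map φ)‖
  rw [havg, hint]
  exact hω

open scoped Matrix.Norms.L2Operator

/-- Second moment minus squared mean, with the factors kept in order. Together with `dispersion_eq`
it reduces the limit to laws of large numbers for the entries of `X` and `X²`. -/
lemma sampleDispersion_eq {T : ℕ} (hT : T ≠ 0) (M : ℕ → Matrix (Fin r) (Fin r) ℝ) :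
    sampleDispersion T M = sampleMean T (fun t => M t * M t) - sampleMean T M * sampleMean T M := by
  have hT' : (T : ℝ) ≠ 0 := by exact_mod_cast hT
  set m := sampleMean T M with hm
  have hsum : ∑ t ∈ Finset.Icc 1 T, M t = (T : ℝ) • m := by
    rw [hm, sampleMean, smul_smul, mul_inv_cancel₀ hT', one_smul]
  have hexp (t : ℕ) : (M t - m) ^ 2 = M t * M t - m * M t - M t * m + m * m := by noncomm_ring
  simp only [sampleDispersion, hexp, Finset.sum_add_distrib, Finset.sum_sub_distrib,
    ← Finset.mul_sum, ← Finset.sum_mul, hsum, Finset.sum_const, Nat.card_Icc,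
    add_tsub_cancel_right, ← Nat.cast_smul_eq_nsmul ℝ, smul_add, smul_sub, Matrix.mul_smul,
    Matrix.smul_mul, smul_smul, inv_mul_cancel₀ hT', one_smul, sampleMean]
  abel

lemma integral_sub_const_mul_sub_const {f g : Ω → ℝ} (hf : Integrable f μ) (hg : Integrable g μ)
    (hfg : Integrable (fun ω => f ω * g ω) μ) (c d : ℝ) :
    Integrable (fun ω => (f ω - c) * (g ω - d)) μ ∧
      ∫ ω, (f ω - c) * (g ω - d) ∂μ =
        ∫ ω, f ω * g ω ∂μ - c * ∫ ω, g ω ∂μ - (∫ ω, f ω ∂μ) * d + c * d := by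
  have he : (fun ω => (f ω - c) * (g ω - d)) =
      fun ω => f ω * g ω - c * g ω - f ω * d + c * d := by
    ext ω
    ring
  have h3 : Integrable (fun ω => c * g ω) μ := hg.const_mul c
  have h4 : Integrable (fun ω => f ω * d) μ := hf.mul_const d
  have h5 : Integrable (fun ω => f ω * g ω - c * g ω) μ := hfg.sub h3
  have h6 : Integrable (fun ω => f ω * g ω - c * g ω - f ω * d) μ := h5.sub h4
  rw [he]
  refine ⟨h6.add (integrable_const _), ?_⟩
  rw [integral_add h6 (integrable_const _), integral_sub h5 h4, integral_sub hfg h3,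
    integral_const_mul, integral_mul_const]
  simp

lemma dispersion_eq {Z : Ω → Matrix (Fin r) (Fin r) ℝ}
    (h1 : ∀ i j, Integrable (fun ω => Z ω i j) μ)
    (h2 : ∀ i j k, Integrable (fun ω => Z ω i k * Z ω k j) μ) :
    dispersion μ Z = expect μ (fun ω => Z ω * Z ω) - expect μ Z * expect μ Z := by
  set m := expect μ Z with hm
  have hmij (i j : Fin r) : ∫ ω, Z ω i j ∂μ = m i j := rfl
  ext i j
  have hcov (k : Fin r) := integral_sub_const_mul_sub_const (h1 i k) (h1 k j) (h2 i j k) (m i k)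
    (m k j)
  simp only [dispersion, expect, Matrix.of_apply, Matrix.sub_apply, sq, Matrix.mul_apply]
  simp only [hmij]
  rw [integral_finsetSum _ fun k _ => (hcov k).1, integral_finsetSum _ fun k _ => h2 i j k,
    ← Finset.sum_sub_distrib]
  exact Finset.sum_congr rfl fun k _ => by
    rw [(hcov k).2, hmij, hmij]
    ring

/-- The sample dispersion of a stationary ergodic process converges in probability to the
population dispersion. -/
lemma IsStationaryErgodic.tendsto_measure_sampleDispersion (hX : IsStationaryErgodic μ X)
    (hmom : Integrable (fun ω => frobNorm (X 1 ω) ^ 3) μ) {η : ℝ} (hη : 0 < η) :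
    Tendsto (fun T : ℕ => μ {ω | η < ‖sampleDispersion T (fun t => X t ω) - dispersion μ (X 1)‖})
      atTop (𝓝 0) := by
  have hmeas := hX.1
  -- For `x ≥ 0` both `x` and `x²` are at most `1 + x³`, so one dominating function serves both
  -- moments.
  have hdom : Integrable (fun ω => 1 + frobNorm (X 1 ω) ^ 3) μ := (integrable_const 1).add hmom
  have h1 (i j : Fin r) : Integrable (fun ω => X 1 ω i j) μ := by
    refine hdom.mono' (hmeas 1 i j).aestronglyMeasurable (ae_of_all _ fun ω => ?_)
    have h := abs_entry_le_frobNorm (X 1 ω) i j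
    have h0 : 0 ≤ frobNorm (X 1 ω) := Real.sqrt_nonneg _
    rw [Real.norm_eq_abs]
    nlinarith [mul_nonneg h0 (sq_nonneg (frobNorm (X 1 ω) - 1)), sq_nonneg (frobNorm (X 1 ω) - 1)]
  have h2 (i j k : Fin r) : Integrable (fun ω => X 1 ω i k * X 1 ω k j) μ := by
    refine hdom.mono' ((hmeas 1 i k).mul (hmeas 1 k j)).aestronglyMeasurable
      (ae_of_all _ fun ω => ?_)
    have ha := abs_entry_le_frobNorm (X 1 ω) i k
    have hb := abs_entry_le_frobNorm (X 1 ω) k j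
    have h0 : 0 ≤ frobNorm (X 1 ω) := Real.sqrt_nonneg _
    rw [Real.norm_eq_abs, abs_mul]
    have hc := mul_le_mul ha hb (abs_nonneg _) h0
    nlinarith [mul_nonneg h0 (sq_nonneg (frobNorm (X 1 ω) - 1)), sq_nonneg (frobNorm (X 1 ω) - 1)]
  set m := expect μ (X 1) with hm
  set P := expect μ (fun ω => X 1 ω * X 1 ω) with hP
  -- Sample and population dispersion are the same continuous function of second moment and mean.
  have hcont : Continuous fun q : Matrix (Fin r) (Fin r) ℝ × Matrix (Fin r) (Fin r) ℝ =>
      q.1 - q.2 * q.2 := by fun_prop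
  obtain ⟨δ, hδ, hδη⟩ := Metric.continuous_iff.1 hcont (P, m) η hη
  -- The `+ 1` makes `unitNormSum r * δ' < δ` strict and covers `r = 0`.
  set δ' : ℝ := δ / (unitNormSum r + 1) with hδ'
  have hκ := unitNormSum_nonneg r
  have hδ'0 : 0 < δ' := by positivity
  have hκδ : unitNormSum r * δ' < δ := by
    rw [hδ', mul_div_assoc', div_lt_iff₀ (by positivity)]
    nlinarith
  set bad₁ : ℕ → Fin r × Fin r → Set Ω := fun T p =>
    {ω | δ' ≤ |(T : ℝ)⁻¹ * ∑ t ∈ Finset.Icc 1 T, X t ω p.1 p.2 - m p.1 p.2|} with hbad₁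
  set bad₂ : ℕ → Fin r × Fin r → Set Ω := fun T p =>
    {ω | δ' ≤ |(T : ℝ)⁻¹ * ∑ t ∈ Finset.Icc 1 T, (X t ω * X t ω) p.1 p.2 - P p.1 p.2|} with hbad₂
  have hlim₁ (p : Fin r × Fin r) : Tendsto (fun T => μ (bad₁ T p)) atTop (𝓝 0) :=
    hX.tendsto_measure_average (G := fun x => x p.1 p.2) (by fun_prop) (h1 p.1 p.2) hδ'0
  have hlim₂ (p : Fin r × Fin r) : Tendsto (fun T => μ (bad₂ T p)) atTop (𝓝 0) :=
    hX.tendsto_measure_average (G := fun x => ∑ k, x p.1 k * x k p.2) (by fun_prop)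
      (integrable_finsetSum _ fun k _ => h2 p.1 p.2 k) hδ'0
  have hlim : Tendsto (fun T => ∑ p, (μ (bad₁ T p) + μ (bad₂ T p))) atTop (𝓝 0) := by
    have := tendsto_finsetSum (Finset.univ : Finset (Fin r × Fin r)) fun p _ =>
      (hlim₁ p).add (hlim₂ p)
    simpa using this
  refine tendsto_of_tendsto_of_tendsto_of_le_of_le' tendsto_const_nhds hlim
    (Eventually.of_forall fun _ => zero_le) ?_
  filter_upwards [eventually_ne_atTop 0] with T hT
  refine le_trans (measure_mono (t := ⋃ p, bad₁ T p ∪ bad₂ T p) ?_)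
    ((measure_iUnion_fintype_le _ _).trans (Finset.sum_le_sum fun p _ => measure_union_le _ _))
  intro ω hω
  by_contra hnot
  simp only [Set.mem_iUnion, Set.mem_union, not_exists, not_or] at hnot
  have e1 : ‖sampleMean T (fun t => X t ω) - m‖ < δ := by
    refine (norm_le_unitNormSum_mul (c := δ') fun i j => ?_).trans_lt hκδ
    have := (hnot (i, j)).1
    simp only [hbad₁, Set.mem_ofPred_eq, not_le] at this
    simpa [sampleMean, Matrix.sum_apply] using this.le
  have e2 : ‖sampleMean T (fun t => X t ω * X t ω) - P‖ < δ := by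
    refine (norm_le_unitNormSum_mul (c := δ') fun i j => ?_).trans_lt hκδ
    have := (hnot (i, j)).2
    simp only [hbad₂, Set.mem_ofPred_eq, not_le] at this
    simpa [sampleMean, Matrix.sum_apply] using this.le
  have e3 := hδη (sampleMean T (fun t => X t ω * X t ω), sampleMean T fun t => X t ω) (by
    rw [Prod.dist_eq, dist_eq_norm, dist_eq_norm]
    exact max_lt e2 e1)
  rw [dist_eq_norm] at e3
  simp only [Set.mem_ofPred_eq] at hω
  rw [sampleDispersion_eq hT, dispersion_eq h1 h2] at hω
  exact lt_asymm hω e3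

end LawOfLargeNumbers

/-! ### The two rates on the good event. -/

section Rates

open scoped Matrix.Norms.L2Operator

/-- Both error bounds on the event on which the factors and the realized covariance errors are
of their typical size and the sample dispersion of the factors has a spectral gap. -/
lemma error_bounds {n r T : ℕ} (hT : T ≠ 0) {Λ : Matrix (Fin n) (Fin r) ℝ}
    {Y₀ : Matrix (Fin n) (Fin n) ℝ} (hΛ : Λᵀ * Λ = 1) (hY₀ : Y₀ᵀ = Y₀) {K : ℝ}
    (hK : specNorm Y₀ ≤ K) {X : ℕ → Matrix (Fin r) (Fin r) ℝ} (hX : ∀ t, (X t).PosDef)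
    {Y : ℕ → Matrix (Fin n) (Fin n) ℝ} (hY : ∀ t, (Y t).IsSymm)
    {V Q : Matrix (Fin r) (Fin r) ℝ} {v : Fin r → ℝ} {g : ℝ} (hV : Vᵀ = V)
    (hQ : Qᵀ * Q = 1) (hv : Antitone v) (hVQ : V * Q = Q * Matrix.diagonal v) (hg : 0 < g)
    (hgv : ∀ j, g ≤ v j) (hgap : ∀ i j, i ≠ j → g ≤ |v i - v j|) {A B CA CB C₁ C₂ : ℝ}
    (hA : 0 ≤ A) (hA1 : A ≤ 1) (hB : 1 ≤ B) (hCA : 0 < CA) (hCB : 0 < CB)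
    (hC₁ : C₁ = 8 * unitNormSum r * CB * CA + 4 * CA ^ 2) (hC₂ : C₂ = (r + 1) * (C₁ / (g / 4)))
    (hXb : ∀ j, maxUpTo T (fun t => |X t j j|) ≤ CB * B)
    (hYa : maxUpTo T (fun t => specNorm (modelCov Λ Y₀ (X t) - Y t)) ≤ CA * A)
    (hXV : specNorm (sampleDispersion T X - V) ≤ g / 4) (hsmall : C₁ * (A * B) ≤ g / 4)
    {F F' : Matrix (Fin n) (Fin r) ℝ}
    (hF : IsLeadingEigenvectors (sampleDispersion T fun t => modelCov Λ Y₀ (X t)) F)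
    (hF' : IsLeadingEigenvectors (sampleDispersion T Y) F')
    (hsign : ∀ j, 0 ≤ (Fᵀ * F') j j) :
    frobNorm (Fᵀ * F' - 1) ≤ r * C₂ * (A * B) ∧
      maxUpTo T (fun t => frobNorm (estFactorCov F' (Y t) - factorCov Λ F Y₀ (X t))) ≤
        r * (CA + 2 * √(2 * unitNormSum r * C₂) * (unitNormSum r * CB + K)) *
          (A ^ (1 / 2 : ℝ) * B ^ (3 / 2 : ℝ)) := by
  have hκ := unitNormSum_nonneg r
  have hB0 : 0 < B := by linarith
  have hAB : 0 ≤ A * B := by positivity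
  have hC₁0 : 0 ≤ C₁ := by rw [hC₁]; positivity
  have hC₂0 : 0 ≤ C₂ := by rw [hC₂]; positivity
  rw [specNorm_eq_norm] at hXV hK
  have hK0 : 0 ≤ K := (norm_nonneg _).trans hK
  have hXsymm (t : ℕ) : (X t)ᵀ = X t := by simpa [Matrix.IsHermitian] using (hX t).isHermitian
  have hXb' : ∀ t ∈ Finset.Icc 1 T, ∀ i j, |X t i j| ≤ CB * B := fun t ht =>
    abs_entry_le_of_posDef (hX t) fun i =>
      (le_maxUpTo (f := fun t => |X t i i|) ht).trans (hXb i)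
  have hYa' : ∀ t ∈ Finset.Icc 1 T, ‖modelCov Λ Y₀ (X t) - Y t‖ ≤ CA * A := fun t ht => by
    rw [← specNorm_eq_norm]
    exact (le_maxUpTo (f := fun t => specNorm (modelCov Λ Y₀ (X t) - Y t)) ht).trans hYa
  -- The quadratic term is absorbed through `A ≤ 1 ≤ B`, which gives `A² ≤ AB`.
  have hεle : 8 * unitNormSum r * (CB * B) * (CA * A) + 4 * (CA * A) ^ 2 ≤ C₁ * (A * B) := by
    have h1 : A * A ≤ A * B := mul_le_mul_of_nonneg_left (hA1.trans hB) hA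
    have h2 : 4 * CA ^ 2 * (A * A) ≤ 4 * CA ^ 2 * (A * B) := by gcongr
    rw [hC₁]
    linarith
  have hent (i j : Fin r) :
      |(Fᵀ * F' - (1 : Matrix (Fin r) (Fin r) ℝ)) i j| ≤ C₂ * (A * B) := by
    refine (abs_transpose_mul_sub_one_le_of_sample hT hΛ hY₀ hXsymm hY hV hQ hv hVQ hg hgv hgap
      (by positivity) (by positivity) hXb' hYa' hXV (hεle.trans hsmall) hF hF' hsign i j).trans ?_
    rw [hC₂, mul_assoc ((r : ℝ) + 1), div_mul_eq_mul_div]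
    gcongr
  refine ⟨?_, ?_⟩
  · rw [mul_assoc]
    exact frobNorm_le (by positivity) hent
  -- `√(AB)` is the eigenvector error and the remaining `B` is the size of the model covariances.
  have hrate : A ^ (1 / 2 : ℝ) * B ^ (3 / 2 : ℝ) = √(A * B) * B := by
    have h1 : B ^ (3 / 2 : ℝ) = √B * B := by
      rw [Real.sqrt_eq_rpow, ← Real.rpow_add_one hB0.ne']
      norm_num
    rw [h1, ← Real.sqrt_eq_rpow, Real.sqrt_mul hA]
    ring
  rw [hrate]
  refine maxUpTo_le (by positivity) fun t ht => ?_
  refine (frobNorm_le_mul_norm _).trans ?_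
  rw [mul_assoc]
  gcongr
  have h1 := norm_estFactorCov_sub_factorCov_le (Λ := Λ) (Y₀ := Y₀) (Y := Y t) (X := X t) hF.1 hF'.1
  have h2 := norm_sub_le_sqrt_of_entries hF.1 hF'.1 hent
  rw [← mul_assoc, Real.sqrt_mul (by positivity)] at h2
  have h3 : ‖modelCov Λ Y₀ (X t)‖ ≤ (unitNormSum r * CB + K) * B := by
    have h4 := norm_modelCov_le (Y₀ := Y₀) hΛ (X t)
    have h5 := norm_le_unitNormSum_mul (hXb' t ht)
    nlinarith
  have h6 : A ≤ √(A * B) * B := by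
    have h7 : A ≤ √(A * B) := Real.le_sqrt_of_sq_le (by nlinarith)
    exact h7.trans (le_mul_of_one_le_right (Real.sqrt_nonneg _) hB)
  calc ‖estFactorCov F' (Y t) - factorCov Λ F Y₀ (X t)‖
      ≤ CA * A + 2 * (√(2 * unitNormSum r * C₂) * √(A * B)) * ((unitNormSum r * CB + K) * B) := by
        refine h1.trans (add_le_add (hYa' t ht) ?_)
        gcongr
    _ ≤ CA * (√(A * B) * B) +
        2 * (√(2 * unitNormSum r * C₂) * √(A * B)) * ((unitNormSum r * CB + K) * B) := by
        gcongr
    _ = _ := by ring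

end Rates

/-! ### Stochastic boundedness by way of exceptional sets. -/

section Probability

variable {Ω ι : Type*} [MeasurableSpace Ω] {μ : Measure Ω} {l : Filter ι}

/-- Monotonicity of the outer measure suffices, so `N` need not be measurable and one `N` can serve
several estimates. -/
lemma IsBigOp.of_bound {Z : ι → Ω → ℝ} {a : ι → ℝ} (h : ∀ ε : ℝ, 0 < ε → ∃ C : ℝ, 0 < C ∧
    ∀ᶠ p in l, ∃ N : Set Ω, μ N ≤ ENNReal.ofReal ε ∧ ∀ ω ∉ N, |Z p ω| ≤ C * a p) :
    IsBigOp μ l Z a := by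
  intro ε hε
  obtain ⟨C, hC, hev⟩ := h ε hε
  refine ⟨C, hC, hev.mono fun p ⟨N, hN, hb⟩ => (measure_mono fun ω hω => ?_).trans hN⟩
  by_contra hωN
  exact not_le.2 hω (hb ω hωN)

/-- Finitely many sequences bounded in probability at the same rate are so jointly. -/
lemma exists_joint_bound {r : ℕ} {Z : Fin r → ι → Ω → ℝ} {a : ι → ℝ} (ha : ∀ p, 0 ≤ a p)
    (h : ∀ j, IsBigOp μ l (Z j) a) {ε : ℝ} (hε : 0 < ε) :
    ∃ C : ℝ, 0 < C ∧
      ∀ᶠ p in l, μ {ω | ∃ j, C * a p < |Z j p ω|} ≤ ENNReal.ofReal ε := by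
  -- The share `ε / (r + 1)` keeps the union bound below `ε` and is defined for `r = 0`.
  choose C hC hev using fun j => h j (ε / (r + 1)) (by positivity)
  have hsum : 0 ≤ ∑ j, C j := Finset.sum_nonneg fun j _ => (hC j).le
  refine ⟨∑ j, C j + 1, by positivity, ?_⟩
  filter_upwards [eventually_all.2 hev] with p hp
  have hsub : {ω | ∃ j, (∑ j, C j + 1) * a p < |Z j p ω|} ⊆ ⋃ j, {ω | C j * a p < |Z j p ω|} := by
    rintro ω ⟨j, hj⟩
    refine Set.mem_iUnion.2 ⟨j, lt_of_le_of_lt ?_ hj⟩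
    have := Finset.single_le_sum (fun j _ => (hC j).le) (Finset.mem_univ j)
    exact mul_le_mul_of_nonneg_right (by linarith) (ha p)
  refine (measure_mono hsub).trans ((measure_iUnion_fintype_le _ _).trans ?_)
  refine (Finset.sum_le_sum fun j _ => hp j).trans ?_
  rw [Finset.sum_const, Finset.card_univ, Fintype.card_fin, nsmul_eq_mul,
    ← ENNReal.ofReal_natCast, ← ENNReal.ofReal_mul (by positivity)]
  refine ENNReal.ofReal_le_ofReal ?_
  rw [mul_div_assoc', div_le_iff₀ (by positivity)]
  nlinarith

end Probability

end FactorModel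

/-! ### Assembly of the theorem. -/

open FactorModel in
theorem theorem5p4
    {Ω : Type*} [MeasurableSpace Ω] (μ : Measure Ω) [IsProbabilityMeasure μ]
    (r : ℕ)
    -- the way in which `(n, m, T)` goes to infinity
    (l : Filter (ℕ × ℕ × ℕ))
    (hn : Tendsto (fun p : ℕ × ℕ × ℕ => p.1) l atTop)
    (hm : Tendsto (fun p : ℕ × ℕ × ℕ => p.2.1) l atTop)
    (hT : Tendsto (fun p : ℕ × ℕ × ℕ => p.2.2) l atTop)
    -- the factor model `Y_t* = Λ X_t Λ' + Y₀`
    (X : ℕ → Ω → Matrix (Fin r) (Fin r) ℝ)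
    (Λ : (n : ℕ) → Matrix (Fin n) (Fin r) ℝ)
    (Y₀ : (n : ℕ) → Matrix (Fin n) (Fin n) ℝ)
    (hX_pos : ∀ t, ∀ᵐ ω ∂μ, (X t ω).PosDef)
    (hY₀_pos : ∀ n, (Y₀ n).PosDef)
    (hΛ : ∀ n, r ≤ n → (Λ n)ᵀ * Λ n = 1)
    -- stationarity, ergodicity and moments; nondegenerate dispersion of the factor process
    (hX_erg : IsStationaryErgodic μ X)
    (hX_mom : ∀ t, Integrable (fun ω => frobNorm (X t ω) ^ 3) μ)
    (hX_disp : HasSimplePositiveSpectrum (dispersion μ (X 1)))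
    -- sparsity
    (δ U : ℝ) (hδ : 0 ≤ δ ∧ δ < 1) (hU : 0 < U) (π : ℕ → ℝ)
    (hΛ_sparse : ∀ n, r ≤ n → ∀ j, IsSparse δ (U * π n) ((Λ n).col j))
    (hY₀_sparse : ∀ n, r ≤ n → ∀ i, IsSparse δ (U * π n) ((Y₀ n).row i))
    -- bounded static part, order of the factor diagonals
    (hY₀_bdd : ∃ K : ℝ, ∀ n, specNorm (Y₀ n) ≤ K)
    (B : ℕ → ℝ) (hB_one : ∀ T, 1 ≤ B T)
    (hB_o : B =o[atTop] (fun T : ℕ => (T : ℝ)))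
    (hX_diag : ∀ j, IsBigOp μ l
      (fun p ω => maxUpTo p.2.2 fun t => |X t ω j j|) (fun p => B p.2.2))
    -- realized covariance matrices and their uniform error
    (Y : (n m T : ℕ) → ℕ → Ω → Matrix (Fin n) (Fin n) ℝ)
    (hY_symm : ∀ n m T t, ∀ᵐ ω ∂μ, (Y n m T t ω).IsSymm)
    (A : ℕ → ℕ → ℕ → ℝ) (hA_nonneg : ∀ n m T, 0 ≤ A n m T)
    (hY_err : IsBigOp μ l
      (fun p ω => maxUpTo p.2.2 fun t =>
        specNorm (modelCov (Λ p.1) (Y₀ p.1) (X t ω) - Y p.1 p.2.1 p.2.2 t ω))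
      (fun p => A p.1 p.2.1 p.2.2))
    (hAB : Tendsto (fun p : ℕ × ℕ × ℕ => A p.1 p.2.1 p.2.2 * B p.2.2 ^ 5) l (𝓝 0))
    -- the sample and the population-model principal components, with matching signs
    (Fhat F : (n m T : ℕ) → Ω → Matrix (Fin n) (Fin r) ℝ)
    (hFhat : ∀ n m T, r ≤ n → ∀ᵐ ω ∂μ,
      IsLeadingEigenvectors (sampleDispersion T fun t => Y n m T t ω) (Fhat n m T ω))
    (hF : ∀ n m T, r ≤ n → ∀ᵐ ω ∂μ,
      IsLeadingEigenvectors (sampleDispersion T fun t => modelCov (Λ n) (Y₀ n) (X t ω))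
        (F n m T ω))
    (hsign : ∀ n m T, r ≤ n → ∀ᵐ ω ∂μ, ∀ j, 0 ≤ ((F n m T ω)ᵀ * Fhat n m T ω) j j) :
    IsBigOp μ l
      (fun p ω => frobNorm ((F p.1 p.2.1 p.2.2 ω)ᵀ * Fhat p.1 p.2.1 p.2.2 ω - 1))
      (fun p => A p.1 p.2.1 p.2.2 * B p.2.2) ∧
    IsBigOp μ l
      (fun p ω => maxUpTo p.2.2 fun t => frobNorm
        (estFactorCov (Fhat p.1 p.2.1 p.2.2 ω) (Y p.1 p.2.1 p.2.2 t ω) -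
          factorCov (Λ p.1) (F p.1 p.2.1 p.2.2 ω) (Y₀ p.1) (X t ω)))
      (fun p => A p.1 p.2.1 p.2.2 ^ (1 / 2 : ℝ) * B p.2.2 ^ (3 / 2 : ℝ)) := by
  obtain ⟨K, hK⟩ := hY₀_bdd
  obtain ⟨hV, Q, v, g, hQ, hv, hVQ, hg, hgv, hgap⟩ := hX_disp.exists_sorted
  have hK0 : 0 ≤ K := by
    refine le_trans ?_ (hK 0)
    exact norm_nonneg _
  have hAB0 (p : ℕ × ℕ × ℕ) : 0 ≤ A p.1 p.2.1 p.2.2 * B p.2.2 :=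
    mul_nonneg (hA_nonneg _ _ _) (zero_le_one.trans (hB_one _))
  -- As `B ≥ 1`, `AB ≤ AB⁵ → 0`.
  have hAlim : ∀ η : ℝ, 0 < η → ∀ᶠ p in l, A p.1 p.2.1 p.2.2 * B p.2.2 ≤ η := fun η hη => by
    filter_upwards [hAB.eventually (eventually_lt_nhds hη)] with p hp
    refine le_trans ?_ hp.le
    exact mul_le_mul_of_nonneg_left (le_self_pow₀ (hB_one _) (by norm_num)) (hA_nonneg _ _ _)
  have hdisp (ε : ℝ) (hε : 0 < ε) : ∀ᶠ p in l,
      μ {ω | g / 4 < specNorm (sampleDispersion p.2.2 (fun t => X t ω) - dispersion μ (X 1))} ≤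
        ENNReal.ofReal ε := by
    have h := (hX_erg.tendsto_measure_sampleDispersion (hX_mom 1)
      (show 0 < g / 4 by positivity)).comp hT
    simp only [← specNorm_eq_norm] at h
    exact (ENNReal.tendsto_nhds_zero.1 h) _ (ENNReal.ofReal_pos.2 hε)
  have key (ε : ℝ) (hε : 0 < ε) : ∃ C : ℝ, 0 < C ∧ ∀ᶠ p in l, ∃ N : Set Ω,
      μ N ≤ ENNReal.ofReal ε ∧ ∀ ω ∉ N,
        frobNorm ((F p.1 p.2.1 p.2.2 ω)ᵀ * Fhat p.1 p.2.1 p.2.2 ω - 1) ≤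
          C * (A p.1 p.2.1 p.2.2 * B p.2.2) ∧
        maxUpTo p.2.2 (fun t => frobNorm
          (estFactorCov (Fhat p.1 p.2.1 p.2.2 ω) (Y p.1 p.2.1 p.2.2 t ω) -
            factorCov (Λ p.1) (F p.1 p.2.1 p.2.2 ω) (Y₀ p.1) (X t ω))) ≤
          C * (A p.1 p.2.1 p.2.2 ^ (1 / 2 : ℝ) * B p.2.2 ^ (3 / 2 : ℝ)) := by
    have hε3 : 0 < ε / 3 := by positivity
    obtain ⟨CA, hCA, hevA⟩ := hY_err (ε / 3) hε3
    obtain ⟨CB, hCB, hevB⟩ := exists_joint_bound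
      (fun p : ℕ × ℕ × ℕ => zero_le_one.trans (hB_one p.2.2)) hX_diag hε3
    have hκ := unitNormSum_nonneg r
    set C₁ : ℝ := 8 * unitNormSum r * CB * CA + 4 * CA ^ 2 with hC₁
    set C₂ : ℝ := (r + 1) * (C₁ / (g / 4)) with hC₂
    set C₃ : ℝ := r * (CA + 2 * √(2 * unitNormSum r * C₂) * (unitNormSum r * CB + K)) with hC₃
    have hC₁0 : 0 < C₁ := by positivity
    have hC₂0 : 0 ≤ C₂ := by positivity
    have hC₃0 : 0 ≤ C₃ := by positivity
    -- The sum dominates the constants of both estimates; the `+ 1` keeps it positive when `r = 0`.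
    refine ⟨r * C₂ + C₃ + 1, by positivity, ?_⟩
    filter_upwards [hevA, hevB, hdisp (ε / 3) hε3, hn.eventually (eventually_ge_atTop r),
      hT.eventually (eventually_ne_atTop 0), hAlim 1 one_pos,
      hAlim (g / 4 / C₁) (by positivity)] with p hpA hpB hpV hpn hpT hp1 hpg
    obtain ⟨n, m, T⟩ := p
    simp only at hpA hpB hpV hpn hpT hp1 hpg ⊢
    have hae : ∀ᵐ ω ∂μ, (∀ t, (X t ω).PosDef) ∧ (∀ t, (Y n m T t ω).IsSymm) ∧
        IsLeadingEigenvectors (sampleDispersion T fun t => Y n m T t ω) (Fhat n m T ω) ∧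
        IsLeadingEigenvectors (sampleDispersion T fun t => modelCov (Λ n) (Y₀ n) (X t ω))
          (F n m T ω) ∧ ∀ j, 0 ≤ ((F n m T ω)ᵀ * Fhat n m T ω) j j := by
      filter_upwards [ae_all_iff.2 hX_pos, ae_all_iff.2 (hY_symm n m T), hFhat n m T hpn,
        hF n m T hpn, hsign n m T hpn] with ω h1 h2 h3 h4 h5
      exact ⟨h1, h2, h3, h4, h5⟩
    have hnull := ae_iff.1 hae
    -- A null set where the almost sure assumptions fail, and three events of probability at most `ε
    -- / 3`: large errors, large factor diagonals, and a sample dispersion far from its limit.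
    refine ⟨_ ∪ (_ ∪ (_ ∪ _)), (measure_union_le _ _).trans ((add_le_add hnull.le
      ((measure_union_le _ _).trans (add_le_add hpA ((measure_union_le _ _).trans
        (add_le_add hpB hpV))))).trans_eq ?_), fun ω hω => ?_⟩
    · rw [zero_add, ← ENNReal.ofReal_add hε3.le hε3.le, ← ENNReal.ofReal_add hε3.le (by positivity)]
      congr 1
      ring
    simp only [Set.mem_union, Set.mem_ofPred_eq, not_or, not_not, not_lt, not_exists] at hω
    obtain ⟨⟨hXω, hYω, hFhatω, hFω, hsignω⟩, hAω, hBω, hVω⟩ := hω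
    have hA0 := hA_nonneg n m T
    have hB1 := hB_one T
    have hA1 : A n m T ≤ 1 := (le_mul_of_one_le_right hA0 hB1).trans hp1
    have hsmall : C₁ * (A n m T * B T) ≤ g / 4 := by
      rw [le_div_iff₀ hC₁0] at hpg
      linarith
    have hY₀t : (Y₀ n)ᵀ = Y₀ n := by simpa [Matrix.IsHermitian] using (hY₀_pos n).isHermitian
    obtain ⟨h1, h2⟩ := error_bounds hpT (hΛ n hpn) hY₀t (hK n) hXω hYω hV hQ hv hVQ hg hgv hgap
      hA0 hA1 hB1 hCA hCB hC₁ hC₂ (fun j => (le_abs_self _).trans (hBω j))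
      ((le_abs_self _).trans hAω) hVω hsmall hFω hFhatω hsignω
    refine ⟨h1.trans (mul_le_mul_of_nonneg_right ?_ (by positivity)),
      h2.trans (mul_le_mul_of_nonneg_right ?_ (by positivity))⟩
    · linarith
    · have : 0 ≤ r * C₂ := by positivity
      linarith
  constructor
  · refine IsBigOp.of_bound fun ε hε => ?_
    obtain ⟨C, hC, h⟩ := key ε hε
    refine ⟨C, hC, h.mono fun p ⟨N, hN, hb⟩ => ⟨N, hN, fun ω hω => ?_⟩⟩
    rw [abs_of_nonneg (frobNorm_nonneg _)]
    exact (hb ω hω).1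
  · refine IsBigOp.of_bound fun ε hε => ?_
    obtain ⟨C, hC, h⟩ := key ε hε
    refine ⟨C, hC, h.mono fun p ⟨N, hN, hb⟩ => ⟨N, hN, fun ω hω => ?_⟩⟩
    rw [abs_of_nonneg (maxUpTo_nonneg fun _ => frobNorm_nonneg _)]
    exact (hb ω hω).2
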